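/- Conventions. $\hat f(\xi)=\int_{\mathbb{R}^3} f(x)e^{-2\pi i x\cdot\xi}\,dx$; for a (vector-valued) tempered distribution $f$ on $\mathbb{R}^3$ whose Fourier transform is a function, $\|f\|_{\dot H^s}=\big\|(2\pi|\xi|)^s\hat f\big\|_{L^2}$. $H^1_{df}$ is the set of real vector fields $u\in H^1(\mathbb{R}^3;\mathbb{R}^3)$ with $\xi\cdot\hat u(\xi)=0$ for almost every $\xi$. For $u\in H^1_{df}$ let $\omega=\nabla\times u$ and $\omega_h=(\omega_1,\omega_2,0)$. For $2\le p\le\infty$ the Besov norm $\|f\|_{\dot B^{s}_{p,\infty}}$ is $$\sup_{t>0}t^{-s/2}\|e^{t\Delta}f\|_{L^p}\quad\text{if } s<0,\qquad \sup_{j\in\mathbb{Z}}2^{js}\|\Delta_j f\|_{L^p}\quad\text{if } s\ge 0,$$ where $\widehat{\Delta_j f}(\xi)=\varphi(2^{-j}\xi)\hat f(\xi)$ and $\varphi:\mathbb{R}^3\to[0,1]$ is any fixed smooth function supported in an annulus $\{a\le|\xi|\le b\}$, $0<a<b$, with $\sum_{j\in\mathbb{Z}}\varphi(2^{-j}\xi)=1$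 for all $\xi\neq0$. Theorem. Let $\nu>0$, $R_1=\frac{\sqrt3}{2\sqrt2}\pi$, $R_2=\frac{32\pi^4}{3(1+\sqrt2)^4}$, and let $$\Gamma_{2d}=\left\{u\in H^1_{df}:\ \|\omega_h\|_{\dot H^{-1/2}}\exp\left(\frac{\frac14\|u\|_{L^2}^2\|u\|_{\dot H^1}^2-6912\,\pi^4\nu^4}{R_2\nu^3}\right)<R_1\nu\right\}.$$ Then: (i) $\Gamma_{2d}$ is unbounded in $\dot H^{1/2}$: for every $M\geq 0$ there is $u\in\Gamma_{2d}$ with $M<\|u\|_{\dot H^{1/2}}<\infty$. (ii) $\Gamma_{2d}$ is unbounded in $\dot B^{1/2}_{2,\infty}$: for every $M\geq 0$ there is $u\in\Gamma_{2d}$ with $M<\|u\|_{\dot B^{1/2}_{2,\infty}}<\infty$. (iii) For every $2<p\le\infty$, $\Gamma_{2d}$ is bounded in $\dot B^{-1+3/p}_{p,\infty}$: there is a constant $C<\infty$ with $\|u\|_{\dot B^{-1+3/p}_{p,\infty}}\le C$ for all $u\in\Gamma_{2d}$ (with $3/p=0$ if $p=\infty$). -/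

import Mathlib

open MeasureTheory SchwartzMap FourierTransform LineDeriv
open scoped ENNReal NNReal ContDiff

noncomputable section

namespace AlmostTwoDim

/-- Physical (and frequency) space `ℝ³`. -/
abbrev V := EuclideanSpace ℝ (Fin 3)

/-- The complexification `ℂ³` of `ℝ³`. -/
abbrev VC := EuclideanSpace ℂ (Fin 3)

/-- The isometric inclusion `ℝ³ → ℂ³`. -/
def complexify : V →L[ℝ] VC :=
  LinearMap.toContinuousLinearMap
    { toFun := fun v => WithLp.toLp 2 fun i => ((v i : ℝ) : ℂ)
      map_add' := fun v w => by ext i; simp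
      map_smul' := fun c v => by ext i; simp }

/-! ### Tempered distributions with values in `ℂ³` -/

/-- The `i`-th component of a vector-valued tempered distribution. -/
def component (i : Fin 3) (T : 𝓢'(V, VC)) : 𝓢'(V, ℂ) :=
  PointwiseConvergenceCLM.postcomp 𝓢(V, ℂ) (EuclideanSpace.proj i : VC →L[ℂ] ℂ) T

/-- The vector-valued tempered distribution with given components. -/
def ofComponents (S : Fin 3 → 𝓢'(V, ℂ)) : 𝓢'(V, VC) :=
  ∑ i, PointwiseConvergenceCLM.postcomp 𝓢(V, ℂ)
    (ContinuousLinearMap.toSpanSingleton ℂ (EuclideanSpace.single i (1 : ℂ))) (S i)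

theorem component_ofComponents (S : Fin 3 → 𝓢'(V, ℂ)) (i : Fin 3) :
    component i (ofComponents S) = S i := by
  ext ψ
  have h : ofComponents S ψ = ∑ k, S k ψ • (EuclideanSpace.single k (1 : ℂ) : VC) := by
    simp only [ofComponents, Fin.sum_univ_three]
    rfl
  have h' : component i (ofComponents S) ψ = (ofComponents S ψ) i := rfl
  rw [h', h]
  simp [Pi.single_apply]

/-- The distributional partial derivative `∂ᵢ`. -/
def partialDeriv (i : Fin 3) (S : 𝓢'(V, ℂ)) : 𝓢'(V, ℂ) :=
  ∂_{(EuclideanSpace.single i (1 : ℝ) : V)} S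

/-- The distributional curl `∇ × T`. -/
def curl (T : 𝓢'(V, VC)) : 𝓢'(V, VC) :=
  ofComponents
    ![partialDeriv 1 (component 2 T) - partialDeriv 2 (component 1 T),
      partialDeriv 2 (component 0 T) - partialDeriv 0 (component 2 T),
      partialDeriv 0 (component 1 T) - partialDeriv 1 (component 0 T)]

/-- The horizontal part `T_h = (T₁, T₂, 0)`. -/
def horizontal (T : 𝓢'(V, VC)) : 𝓢'(V, VC) :=
  ofComponents ![component 0 T, component 1 T, 0]

/-- The tempered distribution `T` is given by integration against the function `g`. -/
def Represents (T : 𝓢'(V, VC)) (g : V → VC) : Prop :=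
  AEStronglyMeasurable g volume ∧
    ∀ ψ : 𝓢(V, ℂ), Integrable (fun x => ψ x • g x) volume ∧ T ψ = ∫ x, ψ x • g x

/-- The `L^p` norm of a tempered distribution; it is `∞` if `T` is not an `L^p` function.
The representing function is unique up to null sets, so the infimum only extracts it. -/
def lpNorm (p : ℝ≥0∞) (T : 𝓢'(V, VC)) : ℝ≥0∞ :=
  ⨅ (g : V → VC) (_ : Represents T g), eLpNorm g p volume

/-- The homogeneous Sobolev norm `‖T‖_{Ḣ^s} = ‖(2π|ξ|)^s T̂‖_{L²}`; it is `∞` if the Fourier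
transform of `T` is not a function or if the integral diverges. -/
def hDotNorm (s : ℝ) (T : 𝓢'(V, VC)) : ℝ≥0∞ :=
  ⨅ (g : V → VC) (_ : Represents (𝓕 T) g),
    eLpNorm (fun ξ => (((2 * Real.pi * ‖ξ‖) ^ s : ℝ) : ℂ) • g ξ) 2 volume

/-! ### Homogeneous Besov norms with third index `∞` -/

/-- The heat operator `e^{tΔ}`, whose Fourier symbol is `exp(-4π² t |ξ|²)`. -/
def heat (t : ℝ) (T : 𝓢'(V, VC)) : 𝓢'(V, VC) :=
  TemperedDistribution.fourierMultiplierCLM VC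
    (fun ξ : V => ((Real.exp (-(4 * Real.pi ^ 2 * t * ‖ξ‖ ^ 2)) : ℝ) : ℂ)) T

/-- A dyadic (Littlewood–Paley) decomposition of unity: a smooth function `φ` with values in
`[0, 1]`, supported in an annulus, with `∑_{j ∈ ℤ} φ(2^{-j} ξ) = 1` for every `ξ ≠ 0`. -/
structure DyadicPartition where
  /-- the function `φ` -/
  φ : V → ℝ
  contDiff : ContDiff ℝ ∞ φ
  nonneg : ∀ ξ, 0 ≤ φ ξ
  le_one : ∀ ξ, φ ξ ≤ 1
  annulus : ∃ a b : ℝ, 0 < a ∧ ∀ ξ, φ ξ ≠ 0 → a ≤ ‖ξ‖ ∧ ‖ξ‖ ≤ b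
  hasSum : ∀ ξ, ξ ≠ 0 → HasSum (fun j : ℤ => φ ((2 : ℝ) ^ (-j) • ξ)) 1

/-- Dyadic partitions exist: take `φ(ξ) = χ(ξ/2) - χ(ξ)` for a smooth bump function `χ`. -/
instance nonemptyDyadicPartition : Nonempty DyadicPartition := by
  let χ : ContDiffBump (0 : V) := ⟨1, 2, one_pos, one_lt_two⟩
  have one : ∀ ξ : V, ‖ξ‖ ≤ 1 → χ ξ = 1 := fun ξ h =>
    χ.one_of_mem_closedBall (by simpa using h)
  have zero : ∀ ξ : V, 2 ≤ ‖ξ‖ → χ ξ = 0 := fun ξ h =>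
    χ.zero_of_le_dist (by simpa using h)
  have nhalf : ∀ ξ : V, ‖(2⁻¹ : ℝ) • ξ‖ = 2⁻¹ * ‖ξ‖ := fun ξ => by
    rw [norm_smul]; norm_num
  refine ⟨⟨fun ξ => χ ((2⁻¹ : ℝ) • ξ) - χ ξ, ?_, ?_, ?_, ⟨1, 4, one_pos, ?_⟩, ?_⟩⟩
  · exact (χ.contDiff.comp (contDiff_const_smul _)).sub χ.contDiff
  · intro ξ
    rcases le_total ‖ξ‖ 2 with h | h
    · have := one ((2⁻¹ : ℝ) • ξ) (by rw [nhalf]; linarith)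
      have := χ.le_one (x := ξ)
      linarith
    · have := zero ξ h
      have := χ.nonneg' ((2⁻¹ : ℝ) • ξ)
      linarith
  · intro ξ
    have := χ.le_one (x := (2⁻¹ : ℝ) • ξ)
    have := χ.nonneg' ξ
    linarith
  · intro ξ h
    refine ⟨?_, ?_⟩
    · by_contra! hlt
      exact h (by rw [one ξ hlt.le, one _ (by rw [nhalf]; linarith [norm_nonneg ξ]), sub_self])
    · by_contra! hlt
      exact h (by rw [zero ξ (by linarith), zero _ (by rw [nhalf]; linarith), sub_self])
  · intro ξ hξ
    obtain ⟨n, hn1, hn2⟩ := exists_mem_Ico_zpow (norm_pos_iff.2 hξ) (one_lt_two (α := ℝ))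
    have nrm : ∀ k : ℤ, ‖(2 : ℝ) ^ k • ξ‖ = (2 : ℝ) ^ k * ‖ξ‖ := fun k => by
      rw [norm_smul, Real.norm_of_nonneg (by positivity)]
    have big : ∀ k : ℤ, n + 1 ≤ k → χ ((2 : ℝ) ^ (-k) • ξ) = 1 := fun k hk => by
      apply one
      rw [nrm]
      calc (2 : ℝ) ^ (-k) * ‖ξ‖ ≤ 2 ^ (-k) * 2 ^ k := by
            gcongr
            exact hn2.le.trans (zpow_le_zpow_right₀ one_le_two hk)
        _ = 1 := by rw [← zpow_add₀ two_ne_zero]; simp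
    have small : ∀ k : ℤ, k + 1 ≤ n → χ ((2 : ℝ) ^ (-k) • ξ) = 0 := fun k hk => by
      apply zero
      rw [nrm]
      calc (2 : ℝ) = 2 ^ (-k) * 2 ^ (k + 1) := by rw [← zpow_add₀ two_ne_zero]; simp
        _ ≤ 2 ^ (-k) * ‖ξ‖ := by
            gcongr
            exact (zpow_le_zpow_right₀ one_le_two hk).trans hn1
    have shift : ∀ k : ℤ, (2⁻¹ : ℝ) • (2 : ℝ) ^ (-k) • ξ = (2 : ℝ) ^ (-(k + 1)) • ξ := fun k => by
      rw [smul_smul, neg_add, zpow_add₀ two_ne_zero, mul_comm]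
      norm_num
    simp only [shift]
    have key := hasSum_sum_of_ne_finset_zero (L := .unconditional ℤ) (s := {n - 1, n})
      (f := fun k : ℤ => χ ((2 : ℝ) ^ (-(k + 1)) • ξ) - χ ((2 : ℝ) ^ (-k) • ξ)) (by
        intro k hk
        simp only [Finset.mem_insert, Finset.mem_singleton, not_or] at hk
        rcases lt_or_ge k n with h | h
        · rw [small (k + 1) (by omega), small k (by omega), sub_self]
        · rw [big (k + 1) (by omega), big k (by omega), sub_self])
    rw [Finset.sum_pair (by omega)] at key
    convert key using 1
    rw [sub_add_cancel, big (n + 1) le_rfl, small (n - 1) (by omega)]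
    ring

/-- The homogeneous dyadic block `Δ_j`, with Fourier symbol `φ(2^{-j} ξ)`. -/
def dyadicBlock (P : DyadicPartition) (j : ℤ) (T : 𝓢'(V, VC)) : 𝓢'(V, VC) :=
  TemperedDistribution.fourierMultiplierCLM VC
    (fun ξ : V => ((P.φ ((2 : ℝ) ^ (-j) • ξ) : ℝ) : ℂ)) T

open Classical in
/-- The homogeneous Besov norm `‖T‖_{Ḃ^s_{p,∞}}`: for `s < 0` it is
`sup_{t > 0} t^{-s/2} ‖e^{tΔ} T‖_{L^p}`, and for `s ≥ 0` it is
`sup_{j ∈ ℤ} 2^{js} ‖Δ_j T‖_{L^p}`. -/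
def besovNorm (P : DyadicPartition) (s : ℝ) (p : ℝ≥0∞) (T : 𝓢'(V, VC)) : ℝ≥0∞ :=
  if s < 0 then
    ⨆ (t : ℝ) (_ : 0 < t), ENNReal.ofReal (t ^ (-s / 2)) * lpNorm p (heat t T)
  else
    ⨆ j : ℤ, ENNReal.ofReal ((2 : ℝ) ^ ((j : ℝ) * s)) * lpNorm p (dyadicBlock P j T)

/-! ### The set of almost two-dimensional data -/

/-- Real vector fields in `L²(ℝ³; ℝ³)`. -/
abbrev Field := Lp V 2 (volume : Measure V)

/-- A real `L²` vector field as an element of `L²(ℝ³; ℂ³)`. -/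
def toComplex (u : Field) : Lp VC 2 (volume : Measure V) := complexify.compLp u

/-- A real `L²` vector field as a tempered distribution. -/
def toDist (u : Field) : 𝓢'(V, VC) := Lp.toTemperedDistribution (toComplex u)

/-- `u ∈ H¹_df`: `u` is in `H¹(ℝ³; ℝ³)` and `ξ · û(ξ) = 0` for almost every `ξ`. -/
def MemH1df (u : Field) : Prop :=
  TemperedDistribution.MemSobolev 1 2 (toDist u) ∧
    ∀ᵐ ξ : V, ∑ i, ((ξ i : ℝ) : ℂ) * (𝓕 (toComplex u) : Lp VC 2 (volume : Measure V)) ξ i = 0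

/-- The constant `R₁ = √3 π / (2√2)`. -/
def R₁ : ℝ := Real.sqrt 3 / (2 * Real.sqrt 2) * Real.pi

/-- The constant `R₂ = 32 π⁴ / (3 (1 + √2)⁴)`. -/
def R₂ : ℝ := 32 * Real.pi ^ 4 / (3 * (1 + Real.sqrt 2) ^ 4)

/-- The set `Γ_2d` of almost two-dimensional initial data for viscosity `ν`. For `u ∈ H¹` both
homogeneous norms below are finite. -/
def Gamma2d (ν : ℝ) : Set Field :=
  {u | MemH1df u ∧
    (hDotNorm (-1 / 2) (horizontal (curl (toDist u)))).toReal *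
      Real.exp ((1 / 4 * ‖u‖ ^ 2 * (hDotNorm 1 (toDist u)).toReal ^ 2
        - 6912 * Real.pi ^ 4 * ν ^ 4) / (R₂ * ν ^ 3)) < R₁ * ν}

end AlmostTwoDim

end

open AlmostTwoDim

/-!
Everything is computed on the frequency side: a tempered distribution is represented by at most one
function (`Represents.ae_eq`), so the norms of a field `u` are weighted `L²` norms of its Fourier
transform `û`, written `freq u`, and `e^{tΔ} u` and `Δ_j u` are inverse Fourier transforms of cut-off
versions of `û`.

**Boundedness for `p > 2`.** If `ξ · û = 0`, then `|ξ₃| |û|` is at most the size of the Fourier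
transform of the horizontal vorticity. Interpolating with `‖u‖_{Ḣ^{1/2}}`, a small horizontal vorticity
forces the norm `X = ‖weight^{1/2} û‖_{L²}` to be small, where `weight = |ξ₁ ξ₂ ξ₃|^{1/3}` scales like
`|ξ|` but vanishes on the plane `ξ₃ = 0` (`lintegral_weight_mul_freq_le`). The inverse weight is
integrable against Gaussians, so by Cauchy–Schwarz `X` still controls
`t^{1/2} ‖e^{tΔ} u‖_∞` (`lintegral_exp_mul_enorm_le`). Interpolation of `L^∞` with `L²` on a dyadic
block (`p ≤ 3`), or with `L³` for the heat flow (`p > 3`), gives the bound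
`C X^{1 - 2/p} ‖u‖_{Ḣ^{1/2}}^{2/p}` for the critical Besov norm (`exists_besovNorm_le`). The `L³` bound
comes from splitting the frequencies at a radius proportional to the level of a superlevel set
(`lintegral_enorm_fourierInv_cube_le`). On `Γ_2d` the horizontal vorticity is bounded by a Gaussian in
`‖u‖_{L²} ‖u‖_{Ḣ¹} ≥ ‖u‖_{Ḣ^{1/2}}²`, and since `1 - 2/p > 0` it enters with a positive power, which
beats every power of `‖u‖_{Ḣ^{1/2}}` (`exists_besovNorm_Gamma2d_le`).

**Unboundedness for `p = 2`.** Take `û = i α (ξ₂, -ξ₁, 0)` on the slab `1 ≤ |ξ_h| ≤ 2`, `|ξ₃| ≤ ε`, with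
`α` normalised so that `‖u‖_{L²}` is comparable to `M`. All frequencies have size between `1` and `3`, so
`‖u‖_{Ḣ^s}` is comparable to `M` for every `s`, and so is `‖u‖_{Ḃ^{1/2}_{2,∞}}`, because `u` meets a
bounded number of dyadic blocks. The horizontal vorticity is of size `ε M`; letting `ε → 0` with `M`
fixed puts `u` in `Γ_2d` (`exists_slab_field`, `exists_mem_Gamma2d`).
-/

noncomputable section

namespace AlmostTwoDim

/-- Complex vector fields in `L²(ℝ³; ℂ³)`. -/
abbrev L2C := Lp VC 2 (volume : Measure V)

/-! ### Representation of tempered distributions by functions -/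

theorem Represents.locallyIntegrable {T : 𝓢'(V, VC)} {g : V → VC} (h : Represents T g) :
    LocallyIntegrable g volume := by
  intro x
  let χ : ContDiffBump x := ⟨1, 2, one_pos, one_lt_two⟩
  have hc : HasCompactSupport (Complex.ofRealCLM ∘ χ) := χ.hasCompactSupport.comp_left rfl
  have hs : ContDiff ℝ ∞ (Complex.ofRealCLM ∘ χ) := Complex.ofRealCLM.contDiff.comp χ.contDiff
  refine ⟨Metric.closedBall x 1, Metric.closedBall_mem_nhds x one_pos, ?_⟩
  refine ((h.2 (hc.toSchwartzMap hs)).1.integrableOn (s := Metric.closedBall x 1)).congr_fun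
    (fun y hy => ?_) Metric.isClosed_closedBall.measurableSet
  have h1 : χ y = 1 := χ.one_of_mem_closedBall hy
  simp [h1]

/-- A tempered distribution is represented by at most one function up to null sets. -/
theorem Represents.ae_eq {T : 𝓢'(V, VC)} {g g' : V → VC} (h : Represents T g)
    (h' : Represents T g') : g =ᵐ[volume] g' := by
  refine ae_eq_of_integral_contDiff_smul_eq h.locallyIntegrable h'.locallyIntegrable
    fun χ hχ hχc => ?_
  have hc : HasCompactSupport (Complex.ofRealCLM ∘ χ) := hχc.comp_left rfl
  have hs : ContDiff ℝ ∞ (Complex.ofRealCLM ∘ χ) := Complex.ofRealCLM.contDiff.comp hχ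
  have e := (h.2 (hc.toSchwartzMap hs)).2.symm.trans (h'.2 (hc.toSchwartzMap hs)).2
  simpa using e

theorem lpNorm_eq {T : 𝓢'(V, VC)} {g : V → VC} (h : Represents T g) (p : ℝ≥0∞) :
    lpNorm p T = eLpNorm g p volume :=
  le_antisymm (iInf₂_le g h)
    (le_iInf₂ fun _ h' => (eLpNorm_congr_ae (h.ae_eq h')).le)

theorem hDotNorm_eq {T : 𝓢'(V, VC)} {g : V → VC} (h : Represents (𝓕 T) g) (s : ℝ) :
    hDotNorm s T =
      eLpNorm (fun ξ => (((2 * Real.pi * ‖ξ‖) ^ s : ℝ) : ℂ) • g ξ) 2 volume := by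
  refine le_antisymm (iInf₂_le g h) (le_iInf₂ fun g' h' => (eLpNorm_congr_ae ?_).le)
  filter_upwards [h.ae_eq h'] with ξ hξ
  rw [hξ]

theorem represents_toTemperedDistribution (v : L2C) :
    Represents (v : 𝓢'(V, VC)) v :=
  ⟨Lp.aestronglyMeasurable v, fun ψ => ⟨memLp_one_iff_integrable.1 ((Lp.memLp v).smul (ψ.memLp 2 volume)),
    Lp.toTemperedDistribution_apply v ψ⟩⟩

theorem Represents.congr {T : 𝓢'(V, VC)} {g g' : V → VC} (h : Represents T g)
    (e : g =ᵐ[volume] g') : Represents T g' := by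
  refine ⟨h.1.congr e, fun ψ => ?_⟩
  have e' : (fun x => ψ x • g x) =ᵐ[volume] fun x => ψ x • g' x := by
    filter_upwards [e] with x hx
    rw [hx]
  exact ⟨(h.2 ψ).1.congr e', (h.2 ψ).2.trans (integral_congr_ae e')⟩

theorem Represents.smulLeftCLM {T : 𝓢'(V, VC)} {g : V → VC} (h : Represents T g) {m : V → ℂ}
    (hm : m.HasTemperateGrowth) :
    Represents (TemperedDistribution.smulLeftCLM VC m T) (fun x => m x • g x) := by
  refine ⟨hm.1.continuous.aestronglyMeasurable.smul h.1, fun ψ => ?_⟩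
  have := h.2 (SchwartzMap.smulLeftCLM ℂ m ψ)
  simp only [SchwartzMap.smulLeftCLM_apply_apply hm, smul_eq_mul, mul_comm (m _), mul_smul] at this
  exact this

/-- The inverse Fourier transform of an integrable `L²` function is given by the usual integral. -/
theorem represents_fourierInv (h : L2C) (hi : Integrable (h : V → VC) volume) :
    Represents (𝓕⁻ (h : 𝓢'(V, VC))) (𝓕⁻ (h : V → VC)) := by
  have hcont : Continuous (𝓕⁻ (h : V → VC)) :=
    VectorFourier.fourierIntegral_continuous Real.continuous_fourierChar
      (continuous_inner (𝕜 := ℝ) (E := V)).neg hi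
  have hb : ∀ x, ‖𝓕⁻ (h : V → VC) x‖ ≤ ∫ ξ, ‖h ξ‖ := fun x =>
    VectorFourier.norm_fourierIntegral_le_integral_norm _ _ _ _ _
  refine ⟨hcont.aestronglyMeasurable, fun ψ => ⟨?_, ?_⟩⟩
  · exact ψ.integrable.smul_bdd _ hcont.aestronglyMeasurable (Filter.Eventually.of_forall hb)
  · rw [TemperedDistribution.fourierInv_apply, Lp.toTemperedDistribution_apply]
    have := VectorFourier.integral_fourierIntegral_smul_eq_flip (μ := (volume : Measure V))
      (ν := (volume : Measure V)) (L := -innerₗ V) Real.continuous_fourierChar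
      (continuous_inner (𝕜 := ℝ) (E := V)).neg ψ.integrable hi
    have hflip : (-innerₗ V).flip = -innerₗ V := by
      ext x y
      simp [real_inner_comm]
    rw [hflip] at this
    rw [SchwartzMap.fourierInv_coe]
    exact this

theorem fourierInv_ae_eq (h : L2C) (hi : Integrable (h : V → VC) volume) :
    ((𝓕⁻ h : L2C) : V → VC) =ᵐ[volume] 𝓕⁻ (h : V → VC) := by
  refine (represents_toTemperedDistribution _).ae_eq ?_
  rw [← Lp.fourierInv_toTemperedDistribution_eq]
  exact represents_fourierInv h hi

/-- The trivial case `p' = 1` of the Hausdorff–Young inequality. -/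
theorem eLpNorm_top_fourierInv_le (h : L2C) :
    eLpNorm ((𝓕⁻ h : L2C) : V → VC) ∞ volume ≤ ∫⁻ ξ, ‖h ξ‖ₑ := by
  by_cases hi : Integrable (h : V → VC) volume
  · rw [eLpNorm_congr_ae (fourierInv_ae_eq h hi), ← ofReal_integral_norm_eq_lintegral_enorm hi]
    refine (eLpNorm_le_of_ae_bound (C := ∫ ξ, ‖h ξ‖) (Filter.Eventually.of_forall fun x => ?_)).trans
      (by simp)
    exact VectorFourier.norm_fourierIntegral_le_integral_norm _ _ _ _ _
  · have : ∫⁻ ξ, ‖h ξ‖ₑ = ⊤ := by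
      by_contra hne
      exact hi ⟨Lp.aestronglyMeasurable h, lt_top_iff_ne_top.2 hne⟩
    simp [this]

theorem enorm_fourierInv (h : L2C) :
    eLpNorm ((𝓕⁻ h : L2C) : V → VC) 2 volume = eLpNorm h 2 volume := by
  rw [← Lp.enorm_def, ← Lp.enorm_def, ← ofReal_norm, ← ofReal_norm]
  congr 1
  exact (Lp.fourierTransformₗᵢ V VC).symm.norm_map h

/-- A Fourier multiplier with bounded symbol `m` maps `v ∈ L²` to `𝓕⁻ (m • 𝓕 v)`. -/
theorem fourierMultiplierCLM_toTemperedDistribution (v : L2C) {m : V → ℂ}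
    (hm : m.HasTemperateGrowth) (hb : MemLp (fun ξ => m ξ • (𝓕 v : L2C) ξ) 2 volume) :
    TemperedDistribution.fourierMultiplierCLM VC m (v : 𝓢'(V, VC)) =
      ((𝓕⁻ (hb.toLp _) : L2C) : 𝓢'(V, VC)) := by
  rw [TemperedDistribution.fourierMultiplierCLM_apply, ← Lp.fourierInv_toTemperedDistribution_eq,
    Lp.fourier_toTemperedDistribution_eq]
  congr 1
  ext1 ψ
  have h1 := ((represents_toTemperedDistribution (𝓕 v)).smulLeftCLM hm).2 ψ
  have h2 := ((represents_toTemperedDistribution (hb.toLp _)).congr hb.coeFn_toLp).2 ψ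
  rw [h1.2, h2.2]

/-! ### Frequency-side estimates with an anisotropic weight -/

/-- The weight `|ξ₁|^{1/3} |ξ₂|^{1/3} |ξ₃|^{1/3}`. It is homogeneous of degree one, like `|ξ|`, but
degenerates on the coordinate planes, in particular on `ξ₃ = 0`, the frequency support of
two-dimensional flows. -/
def weight (ξ : V) : ℝ := ∏ i, |ξ i| ^ (1 / 3 : ℝ)

theorem weight_nonneg (ξ : V) : 0 ≤ weight ξ := Finset.prod_nonneg fun _ _ => by positivity

theorem measurable_weight : Measurable weight := by
  unfold weight
  fun_prop

theorem integral_abs_rpow_inv_mul_exp {b : ℝ} (hb : 0 < b) :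
    ∫ x : ℝ, (|x| ^ (1 / 3 : ℝ))⁻¹ * Real.exp (-b * x ^ 2) =
      b ^ (-(1 / 3) : ℝ) * Real.Gamma (1 / 3) := by
  have h1 := integral_comp_abs (f := fun x : ℝ => (x ^ (1 / 3 : ℝ))⁻¹ * Real.exp (-b * x ^ 2))
  simp only [sq_abs] at h1
  have h2 := integral_rpow_mul_exp_neg_mul_rpow (p := 2) (q := -(1 / 3)) two_pos (by norm_num) hb
  rw [h1]
  have h3 : ∫ x in Set.Ioi (0 : ℝ), (x ^ (1 / 3 : ℝ))⁻¹ * Real.exp (-b * x ^ 2) =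
      ∫ x in Set.Ioi (0 : ℝ), x ^ (-(1 / 3) : ℝ) * Real.exp (-b * x ^ (2 : ℝ)) := by
    refine setIntegral_congr_fun measurableSet_Ioi fun x hx => ?_
    simp only [Real.rpow_neg (le_of_lt hx), Real.rpow_two]
  rw [h3, h2]
  norm_num
  ring

theorem integral_weight_inv_mul_exp {b : ℝ} (hb : 0 < b) :
    ∫ ξ : V, (weight ξ)⁻¹ * Real.exp (-b * ‖ξ‖ ^ 2) = b⁻¹ * Real.Gamma (1 / 3) ^ 3 := by
  have h0 : ∀ ξ : V, (weight ξ)⁻¹ * Real.exp (-b * ‖ξ‖ ^ 2) =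
      ∏ i, ((|ξ i| ^ (1 / 3 : ℝ))⁻¹ * Real.exp (-b * ξ i ^ 2)) := fun ξ => by
    rw [Finset.prod_mul_distrib, ← Real.exp_sum, ← Finset.mul_sum, EuclideanSpace.norm_sq_eq,
      weight, Finset.prod_inv_distrib]
    simp
  simp only [h0]
  have h1 := (PiLp.volume_preserving_ofLp (Fin 3)).integral_comp
    (MeasurableEquiv.toLp 2 (Fin 3 → ℝ)).symm.measurableEmbedding
    (fun y : Fin 3 → ℝ => ∏ i, ((|y i| ^ (1 / 3 : ℝ))⁻¹ * Real.exp (-b * y i ^ 2)))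
  refine h1.trans ?_
  rw [integral_fintype_prod_volume_eq_pow
    (fun x : ℝ => (|x| ^ (1 / 3 : ℝ))⁻¹ * Real.exp (-b * x ^ 2)), integral_abs_rpow_inv_mul_exp hb,
    mul_pow, ← Real.rpow_natCast, Fintype.card_fin, ← Real.rpow_mul hb.le]
  norm_num [Real.rpow_neg_one]

theorem lintegral_weight_inv_mul_exp {b : ℝ} (hb : 0 < b) :
    ∫⁻ ξ : V, ENNReal.ofReal ((weight ξ)⁻¹ * Real.exp (-b * ‖ξ‖ ^ 2)) =
      ENNReal.ofReal (b⁻¹ * Real.Gamma (1 / 3) ^ 3) := by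
  have hG : 0 < Real.Gamma (1 / 3) := Real.Gamma_pos_of_pos (by norm_num)
  rw [← integral_weight_inv_mul_exp hb, ofReal_integral_eq_lintegral_ofReal]
  · -- The Bochner integral of a non-integrable function is zero.
    refine not_imp_comm.1 integral_undef ?_
    rw [integral_weight_inv_mul_exp hb]
    positivity
  · exact Filter.Eventually.of_forall fun ξ =>
      mul_nonneg (inv_nonneg.2 (weight_nonneg ξ)) (Real.exp_pos _).le

theorem ae_weight_pos : ∀ᵐ ξ : V, 0 < weight ξ := by
  have h : ∀ i : Fin 3, ∀ᵐ ξ : V, ξ i ≠ 0 := fun i => by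
    have h1 : ∀ᵐ y : Fin 3 → ℝ, y i ≠ 0 :=
      (Measure.quasiMeasurePreserving_eval (fun _ : Fin 3 => (volume : Measure ℝ)) i).ae
        (Measure.ae_ne volume 0)
    exact (PiLp.volume_preserving_ofLp (Fin 3)).quasiMeasurePreserving.ae h1
  filter_upwards [h 0, h 1, h 2] with ξ h0 h1 h2
  refine Finset.prod_pos fun i _ => Real.rpow_pos_of_pos (abs_pos.2 ?_) _
  fin_cases i <;> assumption

/-- The constant `(Γ(1/3)³ / (8π²))^{1/2}` in the weighted bound for the heat flow. -/
def heatConst : ℝ := Real.sqrt (Real.Gamma (1 / 3) ^ 3 / (8 * Real.pi ^ 2))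

theorem heatConst_pos : 0 < heatConst := by
  have : 0 < Real.Gamma (1 / 3) := Real.Gamma_pos_of_pos (by norm_num)
  unfold heatConst
  positivity

/-- Cauchy–Schwarz against `weight`: the mass of the heat-damped frequencies. -/
theorem lintegral_exp_mul_enorm_le {h : V → VC} (hm : AEStronglyMeasurable h volume) {X : ℝ}
    (hX : 0 ≤ X) (hh : ∫⁻ ξ, ENNReal.ofReal (weight ξ) * ‖h ξ‖ₑ ^ 2 ≤ ENNReal.ofReal (X ^ 2))
    {t : ℝ} (ht : 0 < t) :
    ∫⁻ ξ, ENNReal.ofReal (Real.exp (-(4 * Real.pi ^ 2 * t * ‖ξ‖ ^ 2))) * ‖h ξ‖ₑ ≤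
      ENNReal.ofReal (heatConst * t ^ (-(1 / 2) : ℝ) * X) := by
  have hG : 0 < Real.Gamma (1 / 3) := Real.Gamma_pos_of_pos (by norm_num)
  have hmw := measurable_weight
  have hb : 0 < 8 * Real.pi ^ 2 * t := by positivity
  have key := ENNReal.lintegral_mul_norm_pow_le (μ := (volume : Measure V))
    (f := fun ξ => ENNReal.ofReal ((weight ξ)⁻¹ * Real.exp (-(8 * Real.pi ^ 2 * t) * ‖ξ‖ ^ 2)))
    (g := fun ξ => ENNReal.ofReal (weight ξ) * ‖h ξ‖ₑ ^ 2)
    (by fun_prop) (by fun_prop) (p := 1 / 2) (q := 1 / 2) (by norm_num) (by norm_num) (by norm_num)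
  rw [lintegral_weight_inv_mul_exp hb] at key
  calc _ = _ := lintegral_congr_ae ?_
    _ ≤ _ := key
    _ ≤ ENNReal.ofReal ((8 * Real.pi ^ 2 * t)⁻¹ * Real.Gamma (1 / 3) ^ 3) ^ (1 / 2 : ℝ) *
        ENNReal.ofReal (X ^ 2) ^ (1 / 2 : ℝ) := by gcongr
    _ = _ := ?_
  · filter_upwards [ae_weight_pos] with ξ hξ
    have e1 : ‖h ξ‖ₑ = (‖h ξ‖ₑ ^ 2) ^ (1 / 2 : ℝ) := by
      rw [← ENNReal.rpow_natCast, ← ENNReal.rpow_mul]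
      norm_num
    rw [ENNReal.mul_rpow_of_nonneg _ _ (by norm_num : (0 : ℝ) ≤ 1 / 2), ← e1, ← mul_assoc,
      ENNReal.ofReal_rpow_of_nonneg (by positivity) (by norm_num),
      ENNReal.ofReal_rpow_of_nonneg hξ.le (by norm_num),
      ← ENNReal.ofReal_mul (by positivity), ← Real.mul_rpow (by positivity) hξ.le,
      mul_right_comm _ _ (weight ξ), inv_mul_cancel₀ hξ.ne', one_mul, ← Real.exp_mul]
    congr 3
    ring
  · rw [ENNReal.ofReal_rpow_of_nonneg (by positivity) (by norm_num),
      ENNReal.ofReal_rpow_of_nonneg (by positivity) (by norm_num),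
      ← ENNReal.ofReal_mul (by positivity), ← Real.sqrt_eq_rpow, ← Real.sqrt_eq_rpow,
      Real.sqrt_sq hX, Real.rpow_neg ht.le, ← Real.sqrt_eq_rpow, heatConst, ← Real.sqrt_inv,
      ← Real.sqrt_mul (by positivity)]
    congr 3
    field_simp

/-- The constant in the weighted bound for low frequencies. -/
def lowConst : ℝ := Real.exp (4 * Real.pi ^ 2) * heatConst

theorem lowConst_pos : 0 < lowConst := mul_pos (Real.exp_pos _) heatConst_pos

/-- Bernstein-type bound: the mass of the frequencies in a ball of radius `R`. -/
theorem setLIntegral_enorm_le {h : V → VC} (hm : AEStronglyMeasurable h volume) {X : ℝ}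
    (hX : 0 ≤ X) (hh : ∫⁻ ξ, ENNReal.ofReal (weight ξ) * ‖h ξ‖ₑ ^ 2 ≤ ENNReal.ofReal (X ^ 2))
    {R : ℝ} (hR : 0 < R) :
    ∫⁻ ξ in Metric.closedBall 0 R, ‖h ξ‖ₑ ≤ ENNReal.ofReal (lowConst * R * X) := by
  have ht : 0 < (R ^ 2)⁻¹ := by positivity
  calc ∫⁻ ξ in Metric.closedBall 0 R, ‖h ξ‖ₑ
      ≤ ∫⁻ ξ in Metric.closedBall 0 R, ENNReal.ofReal (Real.exp (4 * Real.pi ^ 2)) *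
          (ENNReal.ofReal (Real.exp (-(4 * Real.pi ^ 2 * (R ^ 2)⁻¹ * ‖ξ‖ ^ 2))) * ‖h ξ‖ₑ) := by
        refine setLIntegral_mono' Metric.isClosed_closedBall.measurableSet fun ξ hξ => ?_
        rw [← mul_assoc, ← ENNReal.ofReal_mul (Real.exp_pos _).le, ← Real.exp_add]
        refine le_mul_of_one_le_left' ?_
        rw [ENNReal.one_le_ofReal, Real.one_le_exp_iff]
        have h1 : ‖ξ‖ ^ 2 ≤ R ^ 2 := by
          have : ‖ξ‖ ≤ R := by simpa using hξ
          gcongr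
        have h2 : (R ^ 2)⁻¹ * ‖ξ‖ ^ 2 ≤ 1 := by
          rw [inv_mul_le_iff₀ (by positivity)]
          linarith
        nlinarith [sq_nonneg Real.pi]
    _ ≤ ∫⁻ ξ, ENNReal.ofReal (Real.exp (4 * Real.pi ^ 2)) *
          (ENNReal.ofReal (Real.exp (-(4 * Real.pi ^ 2 * (R ^ 2)⁻¹ * ‖ξ‖ ^ 2))) * ‖h ξ‖ₑ) :=
        setLIntegral_le_lintegral _ _
    _ ≤ ENNReal.ofReal (Real.exp (4 * Real.pi ^ 2)) *
          ENNReal.ofReal (heatConst * (R ^ 2)⁻¹ ^ (-(1 / 2) : ℝ) * X) := by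
        rw [lintegral_const_mul' _ _ ENNReal.ofReal_ne_top]
        gcongr
        exact lintegral_exp_mul_enorm_le hm hX hh ht
    _ = _ := by
        rw [← ENNReal.ofReal_mul (Real.exp_pos _).le, Real.inv_rpow (by positivity),
          ← Real.rpow_neg (by positivity), neg_neg, ← Real.sqrt_eq_rpow, Real.sqrt_sq hR.le,
          lowConst]
        congr 1
        ring

/-! ### Interpolation -/

theorem lintegral_rpow_le_of_bounded {f : V → VC} {a B p q : ℝ} (hqp : q ≤ p) (hq : 0 < q)
    (ha : 0 ≤ a) (hf : eLpNorm f ⊤ volume ≤ ENNReal.ofReal a)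
    (hB : ∫⁻ x, ‖f x‖ₑ ^ q ≤ ENNReal.ofReal B) :
    ∫⁻ x, ‖f x‖ₑ ^ p ≤ ENNReal.ofReal (a ^ (p - q) * B) := by
  calc ∫⁻ x, ‖f x‖ₑ ^ p ≤ ∫⁻ x, ENNReal.ofReal (a ^ (p - q)) * ‖f x‖ₑ ^ q := by
        refine lintegral_mono_ae ?_
        rw [eLpNorm_exponent_top] at hf
        filter_upwards [ae_le_eLpNormEssSup (f := f) (μ := (volume : Measure V))] with x hx
        have : p = (p - q) + q := by ring
        conv_lhs => rw [this, ENNReal.rpow_add_of_nonneg _ _ (by linarith) hq.le]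
        gcongr
        rw [← ENNReal.ofReal_rpow_of_nonneg ha (by linarith)]
        exact ENNReal.rpow_le_rpow (hx.trans hf) (by linarith)
    _ ≤ _ := by
        rw [lintegral_const_mul' _ _ ENNReal.ofReal_ne_top, ENNReal.ofReal_mul (by positivity)]
        gcongr

theorem eLpNorm_le_of_bounded {f : V → VC} {a B q : ℝ} {p : ℝ≥0∞} (hp : p ≠ ⊤)
    (hqp : q ≤ p.toReal) (hq : 0 < q)
    (ha : 0 ≤ a) (hB0 : 0 ≤ B) (hf : eLpNorm f ⊤ volume ≤ ENNReal.ofReal a)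
    (hB : ∫⁻ x, ‖f x‖ₑ ^ q ≤ ENNReal.ofReal B) :
    eLpNorm f p volume ≤ ENNReal.ofReal ((a ^ (p.toReal - q) * B) ^ (1 / p.toReal)) := by
  have hp0 : p ≠ 0 := by
    rintro rfl
    simp at hqp
    linarith
  have hpos : 0 < p.toReal := by linarith
  rw [eLpNorm_eq_lintegral_rpow_enorm_toReal hp0 hp,
    ← ENNReal.ofReal_rpow_of_nonneg (by positivity) (by positivity)]
  exact ENNReal.rpow_le_rpow (lintegral_rpow_le_of_bounded hqp hq ha hf hB) (by positivity)

/-! ### Plancherel's theorem for extended norms -/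

theorem eLpNorm_two_sq (f : V → VC) : eLpNorm f 2 volume ^ 2 = ∫⁻ x, ‖f x‖ₑ ^ 2 := by
  rw [eLpNorm_eq_lintegral_rpow_enorm_toReal two_ne_zero ENNReal.ofNat_ne_top,
    ← ENNReal.rpow_natCast, ← ENNReal.rpow_mul]
  norm_num

theorem lintegral_enorm_fourierInv_sq (h : L2C) :
    ∫⁻ x, ‖(𝓕⁻ h : L2C) x‖ₑ ^ 2 = ∫⁻ ξ, ‖h ξ‖ₑ ^ 2 := by
  rw [← eLpNorm_two_sq, ← eLpNorm_two_sq, enorm_fourierInv]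

/-! ### The critical Sobolev embedding into `L³` -/

/-- Frequencies of size at most `R`, with `R` proportional to the level `l`, contribute at most
`l / 2` to the value of `𝓕⁻ h`, so the superlevel set is controlled by the higher frequencies. -/
theorem volume_lt_norm_fourierInv_le (h : L2C) {X : ℝ} (hX : 0 < X)
    (hh : ∫⁻ ξ, ENNReal.ofReal (weight ξ) * ‖h ξ‖ₑ ^ 2 ≤ ENNReal.ofReal (X ^ 2))
    {l : ℝ} (hl : 0 < l) :
    volume {x | l < ‖(𝓕⁻ h : L2C) x‖} * ENNReal.ofReal (l ^ 2) ≤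
      4 * ∫⁻ ξ in (Metric.closedBall 0 (l / (2 * lowConst * X)))ᶜ, ‖h ξ‖ₑ ^ 2 := by
  have hc := lowConst_pos
  set R := l / (2 * lowConst * X) with hRdef
  have hR : 0 < R := by positivity
  set S : Set V := Metric.closedBall 0 R
  have hS : MeasurableSet S := Metric.isClosed_closedBall.measurableSet
  have mlow := (Lp.memLp h).indicator hS
  have mhigh := (Lp.memLp h).indicator hS.compl
  set low : L2C := mlow.toLp _ with hlow
  set high : L2C := mhigh.toLp _ with hhigh
  have hsum : h = low + high := by
    rw [hlow, hhigh, ← MemLp.toLp_add]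
    simp only [Set.indicator_self_add_compl, Lp.toLp_coeFn]
  have hF : (𝓕⁻ h : L2C) = 𝓕⁻ low + 𝓕⁻ high := by
    rw [hsum, FourierTransform.fourierInv_add]
  have hlowbd : ∀ᵐ x, ‖(𝓕⁻ low : L2C) x‖ ≤ l / 2 := by
    have h1 : eLpNorm ((𝓕⁻ low : L2C) : V → VC) ⊤ volume ≤ ENNReal.ofReal (l / 2) := by
      refine (eLpNorm_top_fourierInv_le low).trans ?_
      have h2 : ∫⁻ ξ, ‖low ξ‖ₑ = ∫⁻ ξ in S, ‖h ξ‖ₑ := by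
        rw [← lintegral_indicator hS]
        refine lintegral_congr_ae ?_
        filter_upwards [mlow.coeFn_toLp] with ξ hξ
        rw [hlow, hξ, enorm_indicator_eq_indicator_enorm]
      rw [h2]
      refine (setLIntegral_enorm_le (Lp.aestronglyMeasurable h) hX.le hh hR).trans ?_
      apply ENNReal.ofReal_le_ofReal
      rw [hRdef]
      apply le_of_eq
      field_simp
    rw [eLpNorm_exponent_top] at h1
    filter_upwards [ae_le_eLpNormEssSup (f := ((𝓕⁻ low : L2C) : V → VC))
      (μ := (volume : Measure V))] with x hx
    have := hx.trans h1
    rwa [← ofReal_norm, ENNReal.ofReal_le_ofReal_iff (by positivity)] at this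
  have hsub : volume {x | l < ‖(𝓕⁻ h : L2C) x‖} ≤
      volume {x | ENNReal.ofReal (l / 2) ^ 2 ≤ ‖(𝓕⁻ high : L2C) x‖ₑ ^ 2} := by
    refine measure_mono_ae ?_
    filter_upwards [hlowbd, Lp.coeFn_add (𝓕⁻ low : L2C) (𝓕⁻ high)] with x h1 h2 h3
    have h3 : l < ‖(𝓕⁻ h : L2C) x‖ := h3
    rw [hF, h2, Pi.add_apply] at h3
    have h4 := norm_add_le ((𝓕⁻ low : L2C) x) ((𝓕⁻ high : L2C) x)
    change ENNReal.ofReal (l / 2) ^ 2 ≤ ‖(𝓕⁻ high : L2C) x‖ₑ ^ 2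
    gcongr
    rw [← ofReal_norm]
    apply ENNReal.ofReal_le_ofReal
    linarith
  have hcheb := mul_meas_ge_le_lintegral₀ (μ := (volume : Measure V))
    (f := fun x => ‖(𝓕⁻ high : L2C) x‖ₑ ^ 2)
    ((Lp.aestronglyMeasurable _).enorm.pow_const 2) (ENNReal.ofReal (l / 2) ^ 2)
  rw [lintegral_enorm_fourierInv_sq] at hcheb
  have hhi : ∫⁻ ξ, ‖high ξ‖ₑ ^ 2 = ∫⁻ ξ in Sᶜ, ‖h ξ‖ₑ ^ 2 := by
    rw [← lintegral_indicator hS.compl]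
    refine lintegral_congr_ae ?_
    filter_upwards [mhigh.coeFn_toLp] with ξ hξ
    rw [hhigh, hξ, enorm_indicator_eq_indicator_enorm]
    by_cases hm : ξ ∈ Sᶜ <;> simp [hm]
  rw [hhi] at hcheb
  have hl2 : ENNReal.ofReal (l ^ 2) = 4 * ENNReal.ofReal (l / 2) ^ 2 := by
    rw [← ENNReal.ofReal_pow (by positivity), ← ENNReal.ofReal_ofNat, ← ENNReal.ofReal_mul (by simp)]
    congr 1
    ring
  calc _ ≤ volume {x | ENNReal.ofReal (l / 2) ^ 2 ≤ ‖(𝓕⁻ high : L2C) x‖ₑ ^ 2} *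
        ENNReal.ofReal (l ^ 2) := by gcongr
    _ = 4 * (ENNReal.ofReal (l / 2) ^ 2 *
        volume {x | ENNReal.ofReal (l / 2) ^ 2 ≤ ‖(𝓕⁻ high : L2C) x‖ₑ ^ 2}) := by
      rw [hl2]; ring
    _ ≤ _ := by gcongr

/-- A refined form of the embedding `Ḣ^{1/2} ⊂ L³`: one of the three factors `‖h‖` is measured with
the weaker anisotropic weight. -/
theorem lintegral_enorm_fourierInv_cube_le (h : L2C) {X : ℝ} (hX : 0 < X)
    (hh : ∫⁻ ξ, ENNReal.ofReal (weight ξ) * ‖h ξ‖ₑ ^ 2 ≤ ENNReal.ofReal (X ^ 2)) :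
    ∫⁻ x, ‖(𝓕⁻ h : L2C) x‖ₑ ^ (3 : ℝ) ≤
      ENNReal.ofReal (24 * lowConst * X) * ∫⁻ ξ, ‖ξ‖ₑ * ‖h ξ‖ₑ ^ 2 := by
  have hc := lowConst_pos
  have hmh : AEMeasurable (fun ξ => ‖h ξ‖ₑ ^ 2) volume :=
    (Lp.aestronglyMeasurable h).enorm.pow_const 2
  have hlayer := lintegral_rpow_eq_lintegral_meas_lt_mul (volume : Measure V)
    (f := fun x => ‖(𝓕⁻ h : L2C) x‖) (Filter.Eventually.of_forall fun x => norm_nonneg _)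
    (Lp.aestronglyMeasurable _).norm.aemeasurable (p := 3) (by norm_num)
  -- the set of pairs `(l, ξ)` for which `ξ` is a high frequency at level `l`
  let E : Set (ℝ × V) := {q | 0 < q.1 ∧ q.1 < 2 * lowConst * X * ‖q.2‖}
  have hE : MeasurableSet E :=
    (measurableSet_lt measurable_const measurable_fst).inter
      (measurableSet_lt measurable_fst (by fun_prop))
  calc ∫⁻ x, ‖(𝓕⁻ h : L2C) x‖ₑ ^ (3 : ℝ)
      = ∫⁻ x, ENNReal.ofReal (‖(𝓕⁻ h : L2C) x‖ ^ (3 : ℝ)) := by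
        refine lintegral_congr fun x => ?_
        rw [← ofReal_norm, ENNReal.ofReal_rpow_of_nonneg (norm_nonneg _) (by norm_num)]
    _ = ENNReal.ofReal 3 * ∫⁻ l in Set.Ioi 0, volume {x | l < ‖(𝓕⁻ h : L2C) x‖} *
          ENNReal.ofReal (l ^ (3 - 1 : ℝ)) := hlayer
    _ ≤ ENNReal.ofReal 3 * ∫⁻ l in Set.Ioi 0,
          4 * ∫⁻ ξ in (Metric.closedBall 0 (l / (2 * lowConst * X)))ᶜ, ‖h ξ‖ₑ ^ 2 := by
        gcongr ENNReal.ofReal 3 * ?_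
        refine setLIntegral_mono' measurableSet_Ioi fun l hl => ?_
        have h2 : l ^ (3 - 1 : ℝ) = l ^ 2 := by
          rw [← Real.rpow_natCast]; norm_num
        rw [h2]
        exact volume_lt_norm_fourierInv_le h hX hh hl
    _ = ENNReal.ofReal 3 * (4 * ∫⁻ l, ∫⁻ ξ, E.indicator 1 (l, ξ) * ‖h ξ‖ₑ ^ 2) := by
        rw [lintegral_const_mul' _ _ (by simp), ← lintegral_indicator measurableSet_Ioi]
        congr 2
        refine lintegral_congr fun l => ?_
        by_cases hl : 0 < l
        · rw [Set.indicator_of_mem (by exact hl), ← lintegral_indicator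
            Metric.isClosed_closedBall.measurableSet.compl]
          refine lintegral_congr fun ξ => ?_
          have hiff : ξ ∈ (Metric.closedBall (0 : V) (l / (2 * lowConst * X)))ᶜ ↔ (l, ξ) ∈ E := by
            simp only [Set.mem_compl_iff, Metric.mem_closedBall, dist_zero_right, not_le, E,
              Set.mem_ofPred_eq, hl, true_and]
            rw [div_lt_iff₀ (by positivity), mul_comm]
          by_cases hm : (l, ξ) ∈ E
          · rw [Set.indicator_of_mem (hiff.2 hm), Set.indicator_of_mem hm]; simp
          · rw [Set.indicator_of_notMem (fun h => hm (hiff.1 h)), Set.indicator_of_notMem hm]; simp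
        · rw [Set.indicator_of_notMem (by exact hl)]
          have : ∀ ξ : V, (l, ξ) ∉ E := fun ξ h => hl h.1
          simp [this]
    _ = ENNReal.ofReal 3 * (4 * ∫⁻ ξ, ENNReal.ofReal (2 * lowConst * X * ‖ξ‖) * ‖h ξ‖ₑ ^ 2) := by
        rw [lintegral_lintegral_swap]
        · congr 2
          refine lintegral_congr fun ξ => ?_
          have hsec : ∀ l, E.indicator (1 : ℝ × V → ℝ≥0∞) (l, ξ) =
              (Set.Ioo 0 (2 * lowConst * X * ‖ξ‖)).indicator 1 l := fun l => rfl
          simp only [hsec]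
          rw [lintegral_mul_const _ (measurable_one.indicator measurableSet_Ioo),
            lintegral_indicator_one measurableSet_Ioo, Real.volume_Ioo, sub_zero]
        · exact ((measurable_one.indicator hE).aemeasurable).mul (hmh.comp_snd)
    _ = _ := by
        have e : ∀ ξ : V, ENNReal.ofReal (2 * lowConst * X * ‖ξ‖) * ‖h ξ‖ₑ ^ 2 =
            ENNReal.ofReal (2 * lowConst * X) * (‖ξ‖ₑ * ‖h ξ‖ₑ ^ 2) := fun ξ => by
          rw [ENNReal.ofReal_mul (by positivity), ofReal_norm, mul_assoc]
        simp only [e]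
        rw [lintegral_const_mul' _ _ ENNReal.ofReal_ne_top, ← mul_assoc, ← mul_assoc]
        congr 1
        rw [← ENNReal.ofReal_ofNat 4, ← ENNReal.ofReal_mul (by norm_num),
          ← ENNReal.ofReal_mul (by norm_num)]
        congr 1
        ring

/-! ### The symbols of the heat flow and of the dyadic blocks -/

theorem hasTemperateGrowth_heatSymbol {t : ℝ} (ht : 0 < t) :
    (fun ξ : V => ((Real.exp (-(4 * Real.pi ^ 2 * t * ‖ξ‖ ^ 2)) : ℝ) : ℂ)).HasTemperateGrowth := by
  have h1 : (fun ξ : V => Real.exp (-(4 * Real.pi ^ 2 * t * ‖ξ‖ ^ 2))).HasTemperateGrowth := by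
    have h2 : (fun ξ : V => -(4 * Real.pi ^ 2 * t * ‖ξ‖ ^ 2)).HasTemperateGrowth := by fun_prop
    refine Function.HasTemperateGrowth.comp' (g := Real.exp) (t := Set.Iio 1) ?_
      isOpen_Iio.uniqueDiffOn Real.contDiff_exp.contDiffOn (fun N => ⟨0, Real.exp 1,
        (Real.exp_pos _).le, fun n _ x hx => ?_⟩) h2
    · rintro _ ⟨ξ, rfl⟩
      have : 0 ≤ 4 * Real.pi ^ 2 * t * ‖ξ‖ ^ 2 := by positivity
      simp only [Set.mem_Iio]
      linarith
    · rw [iteratedFDerivWithin_of_isOpen n isOpen_Iio hx, norm_iteratedFDeriv_eq_norm_iteratedDeriv,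
        iteratedDeriv_eq_iterate, Real.iter_deriv_exp]
      simp only [pow_zero, mul_one, Real.norm_eq_abs, Real.abs_exp]
      exact Real.exp_le_exp.2 (le_of_lt hx)
  exact Function.Complex.hasTemperateGrowth_ofReal.comp h1

theorem DyadicPartition.hasTemperateGrowth_symbol (P : DyadicPartition) (j : ℤ) :
    (fun ξ : V => ((P.φ ((2 : ℝ) ^ (-j) • ξ) : ℝ) : ℂ)).HasTemperateGrowth := by
  obtain ⟨a, b, -, hab⟩ := P.annulus
  have hcs : HasCompactSupport P.φ :=
    HasCompactSupport.of_support_subset_isCompact (isCompact_closedBall (0 : V) b)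
      fun ξ hξ => by simpa using (hab ξ hξ).2
  have h1 : P.φ.HasTemperateGrowth := hcs.hasTemperateGrowth P.contDiff
  exact Function.Complex.hasTemperateGrowth_ofReal.comp (h1.comp (by fun_prop))

/-! ### Besov norms in terms of the Fourier transform -/

/-- The Fourier transform of a real `L²` vector field. -/
def freq (u : Field) : L2C := 𝓕 (toComplex u)

theorem exists_multiplier_eq (u : Field) {m : V → ℂ} (hm : m.HasTemperateGrowth)
    (hb : ∀ ξ, ‖m ξ‖ ≤ 1) :
    ∃ h : L2C, (h : V → VC) =ᵐ[volume] (fun ξ => m ξ • freq u ξ) ∧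
      ∀ p, lpNorm p (TemperedDistribution.fourierMultiplierCLM VC m (toDist u)) =
        eLpNorm ((𝓕⁻ h : L2C) : V → VC) p volume := by
  have hmem : MemLp (fun ξ => m ξ • freq u ξ) 2 volume :=
    (Lp.memLp (freq u)).of_le
      (hm.1.continuous.aestronglyMeasurable.smul (Lp.aestronglyMeasurable _))
      (Filter.Eventually.of_forall fun ξ => by
        rw [norm_smul]
        exact mul_le_of_le_one_left (norm_nonneg _) (hb ξ))
  refine ⟨hmem.toLp _, hmem.coeFn_toLp, fun p => ?_⟩
  rw [toDist, fourierMultiplierCLM_toTemperedDistribution _ hm hmem]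
  exact lpNorm_eq (represents_toTemperedDistribution _) p

theorem exists_heat_eq (u : Field) {t : ℝ} (ht : 0 < t) :
    ∃ h : L2C, (h : V → VC) =ᵐ[volume] (fun ξ =>
        ((Real.exp (-(4 * Real.pi ^ 2 * t * ‖ξ‖ ^ 2)) : ℝ) : ℂ) • freq u ξ) ∧
      ∀ p, lpNorm p (heat t (toDist u)) = eLpNorm ((𝓕⁻ h : L2C) : V → VC) p volume :=
  exists_multiplier_eq u (hasTemperateGrowth_heatSymbol ht) fun ξ => by
    rw [Complex.norm_real, Real.norm_of_nonneg (Real.exp_pos _).le, Real.exp_le_one_iff]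
    have : 0 ≤ 4 * Real.pi ^ 2 * t * ‖ξ‖ ^ 2 := by positivity
    linarith

theorem exists_dyadicBlock_eq (P : DyadicPartition) (j : ℤ) (u : Field) :
    ∃ h : L2C, (h : V → VC) =ᵐ[volume] (fun ξ =>
        ((P.φ ((2 : ℝ) ^ (-j) • ξ) : ℝ) : ℂ) • freq u ξ) ∧
      ∀ p, lpNorm p (dyadicBlock P j (toDist u)) = eLpNorm ((𝓕⁻ h : L2C) : V → VC) p volume :=
  exists_multiplier_eq u (P.hasTemperateGrowth_symbol j) fun ξ => by
    rw [Complex.norm_real, Real.norm_of_nonneg (P.nonneg _)]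
    exact P.le_one _

/-- An annulus containing the support of a dyadic partition. -/
theorem DyadicPartition.exists_annulus (P : DyadicPartition) :
    ∃ a b : ℝ, 0 < a ∧ 0 < b ∧ ∀ (j : ℤ) (ξ : V), P.φ ((2 : ℝ) ^ (-j) • ξ) ≠ 0 →
      a * 2 ^ j ≤ ‖ξ‖ ∧ ‖ξ‖ ≤ b * 2 ^ j := by
  obtain ⟨a, b, ha, hab⟩ := P.annulus
  refine ⟨a, max b 1, ha, lt_max_of_lt_right one_pos, fun j ξ h => ?_⟩
  have h1 := hab _ h
  have h2 : (0 : ℝ) < 2 ^ j := by positivity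
  rw [norm_smul, Real.norm_of_nonneg (by positivity), zpow_neg, ← div_eq_inv_mul,
    le_div_iff₀ h2, div_le_iff₀ h2] at h1
  exact ⟨h1.1, h1.2.trans (by gcongr; exact le_max_left _ _)⟩

/-- The square of the `L²` norm of a dyadic block is controlled by the `Ḣ^{1/2}` norm. -/
theorem lintegral_block_sq_le {P : DyadicPartition} {a b : ℝ} (ha : 0 < a)
    (hab : ∀ (j : ℤ) (ξ : V), P.φ ((2 : ℝ) ^ (-j) • ξ) ≠ 0 → a * 2 ^ j ≤ ‖ξ‖ ∧ ‖ξ‖ ≤ b * 2 ^ j)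
    {u : Field} {N : ℝ} (hN : ∫⁻ ξ, ‖ξ‖ₑ * ‖freq u ξ‖ₑ ^ 2 ≤ ENNReal.ofReal (N ^ 2)) (j : ℤ)
    {h : L2C} (hh : (h : V → VC) =ᵐ[volume]
      (fun ξ => ((P.φ ((2 : ℝ) ^ (-j) • ξ) : ℝ) : ℂ) • freq u ξ)) :
    ∫⁻ ξ, ‖h ξ‖ₑ ^ 2 ≤ ENNReal.ofReal ((a * 2 ^ j)⁻¹ * N ^ 2) := by
  have hpos : 0 < a * 2 ^ j := by positivity
  calc ∫⁻ ξ, ‖h ξ‖ₑ ^ 2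
      ≤ ∫⁻ ξ, ENNReal.ofReal (a * 2 ^ j)⁻¹ * (‖ξ‖ₑ * ‖freq u ξ‖ₑ ^ 2) := by
        refine lintegral_mono_ae ?_
        filter_upwards [hh] with ξ hξ
        rw [hξ, enorm_smul, mul_pow]
        by_cases h0 : P.φ ((2 : ℝ) ^ (-j) • ξ) = 0
        · rw [h0]; simp
        · rw [← mul_assoc]
          gcongr
          have h1 := (hab j ξ h0).1
          rw [← ofReal_norm, ← ofReal_norm, ← ENNReal.ofReal_pow (norm_nonneg _),
            ← ENNReal.ofReal_mul (by positivity), Complex.norm_real,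
            Real.norm_of_nonneg (P.nonneg _)]
          apply ENNReal.ofReal_le_ofReal
          have h2 : P.φ ((2 : ℝ) ^ (-j) • ξ) ^ 2 ≤ 1 := pow_le_one₀ (P.nonneg _) (P.le_one _)
          refine h2.trans ?_
          rwa [inv_mul_eq_div, le_div_iff₀ hpos, one_mul]
    _ ≤ _ := by
        rw [lintegral_const_mul' _ _ ENNReal.ofReal_ne_top, ENNReal.ofReal_mul (by positivity)]
        gcongr

theorem lintegral_block_le {P : DyadicPartition} {a b : ℝ} (hb : 0 < b)
    (hab : ∀ (j : ℤ) (ξ : V), P.φ ((2 : ℝ) ^ (-j) • ξ) ≠ 0 → a * 2 ^ j ≤ ‖ξ‖ ∧ ‖ξ‖ ≤ b * 2 ^ j)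
    {u : Field} {X : ℝ} (hX : 0 ≤ X)
    (hw : ∫⁻ ξ, ENNReal.ofReal (weight ξ) * ‖freq u ξ‖ₑ ^ 2 ≤ ENNReal.ofReal (X ^ 2)) (j : ℤ)
    {h : L2C} (hh : (h : V → VC) =ᵐ[volume]
      (fun ξ => ((P.φ ((2 : ℝ) ^ (-j) • ξ) : ℝ) : ℂ) • freq u ξ)) :
    ∫⁻ ξ, ‖h ξ‖ₑ ≤ ENNReal.ofReal (lowConst * (b * 2 ^ j) * X) := by
  refine le_trans ?_ (setLIntegral_enorm_le (Lp.aestronglyMeasurable (freq u)) hX hw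
    (show 0 < b * 2 ^ j by positivity))
  rw [← lintegral_indicator Metric.isClosed_closedBall.measurableSet]
  refine lintegral_mono_ae ?_
  filter_upwards [hh] with ξ hξ
  rw [hξ, enorm_smul]
  by_cases h0 : P.φ ((2 : ℝ) ^ (-j) • ξ) = 0
  · rw [h0]; simp
  · rw [Set.indicator_of_mem (by simpa using (hab j ξ h0).2)]
    refine mul_le_of_le_one_left' ?_
    rw [← ofReal_norm, Complex.norm_real, Real.norm_of_nonneg (P.nonneg _)]
    exact ENNReal.ofReal_le_one.2 (P.le_one _)

/-- The case `p = ∞`: the bound on `‖e^{tΔ} u‖_∞`. -/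
theorem lintegral_heat_le {u : Field} {X : ℝ} (hX : 0 ≤ X)
    (hw : ∫⁻ ξ, ENNReal.ofReal (weight ξ) * ‖freq u ξ‖ₑ ^ 2 ≤ ENNReal.ofReal (X ^ 2))
    {t : ℝ} (ht : 0 < t) {h : L2C} (hh : (h : V → VC) =ᵐ[volume]
      (fun ξ => ((Real.exp (-(4 * Real.pi ^ 2 * t * ‖ξ‖ ^ 2)) : ℝ) : ℂ) • freq u ξ)) :
    ∫⁻ ξ, ‖h ξ‖ₑ ≤ ENNReal.ofReal (heatConst * t ^ (-(1 / 2) : ℝ) * X) := by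
  refine le_trans (lintegral_congr_ae ?_).le
    (lintegral_exp_mul_enorm_le (Lp.aestronglyMeasurable (freq u)) hX hw ht)
  filter_upwards [hh] with ξ hξ
  rw [hξ, enorm_smul, ← ofReal_norm (E := ℂ), Complex.norm_real,
    Real.norm_of_nonneg (Real.exp_pos _).le]

theorem lintegral_heat_cube_le {u : Field} {X N : ℝ} (hX : 0 < X)
    (hw : ∫⁻ ξ, ENNReal.ofReal (weight ξ) * ‖freq u ξ‖ₑ ^ 2 ≤ ENNReal.ofReal (X ^ 2))
    (hN : ∫⁻ ξ, ‖ξ‖ₑ * ‖freq u ξ‖ₑ ^ 2 ≤ ENNReal.ofReal (N ^ 2))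
    {t : ℝ} (ht : 0 < t) {h : L2C} (hh : (h : V → VC) =ᵐ[volume]
      (fun ξ => ((Real.exp (-(4 * Real.pi ^ 2 * t * ‖ξ‖ ^ 2)) : ℝ) : ℂ) • freq u ξ)) :
    ∫⁻ x, ‖(𝓕⁻ h : L2C) x‖ₑ ^ (3 : ℝ) ≤ ENNReal.ofReal (24 * lowConst * X * N ^ 2) := by
  have hc := lowConst_pos
  have hle : ∀ᵐ ξ, ‖h ξ‖ₑ ≤ ‖freq u ξ‖ₑ := by
    filter_upwards [hh] with ξ hξ
    rw [hξ, enorm_smul]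
    refine mul_le_of_le_one_left' ?_
    rw [← ofReal_norm, Complex.norm_real, Real.norm_of_nonneg (Real.exp_pos _).le]
    rw [ENNReal.ofReal_le_one, Real.exp_le_one_iff]
    have : 0 ≤ 4 * Real.pi ^ 2 * t * ‖ξ‖ ^ 2 := by positivity
    linarith
  have h1 : ∫⁻ ξ, ENNReal.ofReal (weight ξ) * ‖h ξ‖ₑ ^ 2 ≤ ENNReal.ofReal (X ^ 2) := by
    refine le_trans (lintegral_mono_ae ?_) hw
    filter_upwards [hle] with ξ hξ
    gcongr
  refine (lintegral_enorm_fourierInv_cube_le h hX h1).trans ?_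
  rw [ENNReal.ofReal_mul (p := 24 * lowConst * X) (by positivity)]
  gcongr
  refine le_trans (lintegral_mono_ae ?_) hN
  filter_upwards [hle] with ξ hξ
  gcongr

/-- Refined Besov embedding: the anisotropically weighted norm enters with the positive power
`1 - 2/p`. For `p = ∞` the real quotient `2 / p.toReal` is `0`, as it should be. -/
theorem exists_besovNorm_le (P : DyadicPartition) {p : ℝ≥0∞} (hp : 2 < p) :
    ∃ C : ℝ, 0 ≤ C ∧ ∀ (u : Field) (X N : ℝ), 0 < X → 0 ≤ N →
      ∫⁻ ξ, ENNReal.ofReal (weight ξ) * ‖freq u ξ‖ₑ ^ 2 ≤ ENNReal.ofReal (X ^ 2) →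
      ∫⁻ ξ, ‖ξ‖ₑ * ‖freq u ξ‖ₑ ^ 2 ≤ ENNReal.ofReal (N ^ 2) →
      besovNorm P (-1 + (3 / p).toReal) p (toDist u) ≤
        ENNReal.ofReal (C * (X ^ (1 - 2 / p.toReal) * N ^ (2 / p.toReal))) := by
  have hlow := lowConst_pos
  have hheat := heatConst_pos
  have h3p : (3 / p).toReal = 3 / p.toReal := by simp [ENNReal.toReal_div]
  rcases eq_or_ne p ⊤ with rfl | hpt
  · refine ⟨heatConst, hheat.le, fun u X N hX hN hw hNu => ?_⟩
    rw [besovNorm, if_pos (by simp)]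
    refine iSup₂_le fun t ht => ?_
    obtain ⟨h, hh, hlp⟩ := exists_heat_eq u ht
    rw [hlp]
    calc _ ≤ ENNReal.ofReal (t ^ (-(-1 + (3 / (⊤ : ℝ≥0∞)).toReal) / 2)) *
          ENNReal.ofReal (heatConst * t ^ (-(1 / 2) : ℝ) * X) := by
          gcongr
          exact (eLpNorm_top_fourierInv_le h).trans (lintegral_heat_le hX.le hw ht hh)
      _ = _ := by
          rw [← ENNReal.ofReal_mul (by positivity)]
          congr 1
          have : t ^ (1 / 2 : ℝ) * t ^ (-(1 / 2) : ℝ) = 1 := by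
            rw [← Real.rpow_add ht]; simp
          simp only [ENNReal.div_top, ENNReal.toReal_zero, add_zero, neg_neg, ENNReal.toReal_top,
            div_zero, sub_zero, Real.rpow_one, Real.rpow_zero, mul_one]
          linear_combination (heatConst * X) * this
  set q := p.toReal with hq
  have hq2 : 2 < q := by
    have := (ENNReal.toReal_lt_toReal ENNReal.ofNat_ne_top hpt).2 hp
    simpa using this
  have hq0 : 0 < q := by linarith
  by_cases hs : 3 < q
  · refine ⟨(heatConst ^ (q - 3) * (24 * lowConst)) ^ (1 / q), by positivity,
      fun u X N hX hN hw hNu => ?_⟩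
    have hneg : -1 + 3 / q < 0 := by
      rw [neg_add_lt_iff_lt_add, add_zero, div_lt_one hq0]
      exact hs
    rw [h3p, besovNorm, if_pos hneg]
    refine iSup₂_le fun t ht => ?_
    obtain ⟨h, hh, hlp⟩ := exists_heat_eq u ht
    have h1 := eLpNorm_le_of_bounded hpt (q := 3) (by linarith) (by norm_num)
      (show 0 ≤ heatConst * t ^ (-(1 / 2) : ℝ) * X by positivity)
      (show 0 ≤ 24 * lowConst * X * N ^ 2 by positivity)
      ((eLpNorm_top_fourierInv_le h).trans (lintegral_heat_le hX.le hw ht hh))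
      (lintegral_heat_cube_le hX hw hNu ht hh)
    rw [hlp]
    refine (mul_le_mul_right h1 _).trans ?_
    rw [← ENNReal.ofReal_mul (by positivity), ← hq]
    refine ENNReal.ofReal_le_ofReal (le_of_eq ?_)
    have e1 : (heatConst * t ^ (-(1 / 2) : ℝ) * X) ^ (q - 3) * (24 * lowConst * X * N ^ 2) =
        heatConst ^ (q - 3) * (24 * lowConst) * t ^ (-(q - 3) / 2) * (X ^ (q - 2) * N ^ 2) := by
      rw [Real.mul_rpow (by positivity) hX.le, Real.mul_rpow (by positivity) (by positivity),
        ← Real.rpow_mul ht.le, show q - 2 = (q - 3) + 1 by ring, Real.rpow_add_one hX.ne',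
        show -(1 / 2) * (q - 3) = -(q - 3) / 2 by ring]
      ring
    have hK : 0 ≤ heatConst ^ (q - 3) * (24 * lowConst) := by positivity
    rw [e1]
    generalize heatConst ^ (q - 3) * (24 * lowConst) = K at hK ⊢
    rw [Real.mul_rpow (by positivity) (by positivity), Real.mul_rpow (by positivity) (by positivity), Real.mul_rpow (by positivity) (by positivity),
      ← Real.rpow_mul ht.le, ← Real.rpow_mul hX.le, ← Real.rpow_natCast N 2, ← Real.rpow_mul hN,
      show (q - 2) * (1 / q) = 1 - 2 / q by field_simp,
      show ((2 : ℕ) : ℝ) * (1 / q) = 2 / q by push_cast; ring]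
    have e2 : t ^ (-(-1 + 3 / q) / 2) * t ^ (-(q - 3) / 2 * (1 / q)) = 1 := by
      rw [← Real.rpow_add ht, show -(-1 + 3 / q) / 2 + -(q - 3) / 2 * (1 / q) = 0 by
        field_simp; ring, Real.rpow_zero]
    linear_combination (K ^ (1 / q) *
      (X ^ (1 - 2 / q) * N ^ (2 / q))) * e2
  · obtain ⟨a, b, ha, hb, hab⟩ := P.exists_annulus
    refine ⟨((lowConst * b) ^ (q - 2) * a⁻¹) ^ (1 / q), by positivity,
      fun u X N hX hN hw hNu => ?_⟩
    have hnn : ¬ (-1 + 3 / q < 0) := by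
      rw [neg_add_lt_iff_lt_add, add_zero, div_lt_one hq0]
      exact hs
    rw [h3p, besovNorm, if_neg hnn]
    refine iSup_le fun j => ?_
    obtain ⟨h, hh, hlp⟩ := exists_dyadicBlock_eq P j u
    set D : ℝ := 2 ^ j with hD
    have hDpos : 0 < D := by positivity
    have h1 := eLpNorm_le_of_bounded (f := ((𝓕⁻ h : L2C) : V → VC)) hpt (q := 2) (by linarith)
      (by norm_num) (show 0 ≤ lowConst * (b * D) * X by positivity)
      (show 0 ≤ (a * D)⁻¹ * N ^ 2 by positivity)
      ((eLpNorm_top_fourierInv_le h).trans (lintegral_block_le hb hab hX.le hw j hh))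
      (by
        simp only [ENNReal.rpow_two]
        rw [lintegral_enorm_fourierInv_sq]
        exact lintegral_block_sq_le ha hab hNu j hh)
    rw [hlp]
    refine (mul_le_mul_right h1 _).trans ?_
    rw [← ENNReal.ofReal_mul (by positivity), ← hq]
    refine ENNReal.ofReal_le_ofReal (le_of_eq ?_)
    have e0 : (2 : ℝ) ^ ((j : ℝ) * (-1 + 3 / q)) = D ^ (-1 + 3 / q) := by
      rw [Real.rpow_mul (by norm_num), Real.rpow_intCast]
    have e1 : (lowConst * (b * D) * X) ^ (q - 2) * ((a * D)⁻¹ * N ^ 2) =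
        (lowConst * b) ^ (q - 2) * a⁻¹ * D ^ (q - 3) * (X ^ (q - 2) * N ^ 2) := by
      rw [← mul_assoc lowConst, Real.mul_rpow (by positivity) hX.le,
        Real.mul_rpow (by positivity) (by positivity),
        show q - 3 = (q - 2) - 1 by ring, Real.rpow_sub_one hDpos.ne', mul_inv]
      ring
    have hK : 0 ≤ (lowConst * b) ^ (q - 2) * a⁻¹ := by positivity
    rw [e0, e1]
    generalize (lowConst * b) ^ (q - 2) * a⁻¹ = K at hK ⊢
    rw [Real.mul_rpow (by positivity) (by positivity),
      Real.mul_rpow (by positivity) (by positivity), Real.mul_rpow (by positivity) (by positivity),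
      ← Real.rpow_mul hDpos.le, ← Real.rpow_mul hX.le, ← Real.rpow_natCast N 2,
      ← Real.rpow_mul hN, show (q - 2) * (1 / q) = 1 - 2 / q by field_simp,
      show ((2 : ℕ) : ℝ) * (1 / q) = 2 / q by push_cast; ring]
    have e2 : D ^ (-1 + 3 / q) * D ^ ((q - 3) * (1 / q)) = 1 := by
      rw [← Real.rpow_add hDpos, show -1 + 3 / q + (q - 3) * (1 / q) = 0 by
        field_simp; ring, Real.rpow_zero]
    linear_combination (K ^ (1 / q) *
      (X ^ (1 - 2 / q) * N ^ (2 / q))) * e2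

/-! ### Sobolev norms and the vorticity on the Fourier side -/

theorem norm_complexify (v : V) : ‖complexify v‖ = ‖v‖ := by
  rw [EuclideanSpace.norm_eq, EuclideanSpace.norm_eq]
  congr 1
  refine Finset.sum_congr rfl fun i _ => ?_
  change ‖((v i : ℝ) : ℂ)‖ ^ 2 = _
  rw [Complex.norm_real]

theorem norm_toComplex (u : Field) : ‖toComplex u‖ = ‖u‖ := by
  rw [Lp.norm_def, Lp.norm_def]
  congr 1
  refine eLpNorm_congr_norm_ae ?_
  filter_upwards [complexify.coeFn_compLp u] with x hx
  rw [toComplex, hx, norm_complexify]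

theorem lintegral_freq_sq (u : Field) : ∫⁻ ξ, ‖freq u ξ‖ₑ ^ 2 = ENNReal.ofReal (‖u‖ ^ 2) := by
  have h : ‖freq u‖ = ‖u‖ := (Lp.norm_fourier_eq _).trans (norm_toComplex u)
  rw [← eLpNorm_two_sq, ← Lp.enorm_def, ← ofReal_norm, h, ENNReal.ofReal_pow (norm_nonneg _)]

theorem represents_freq (u : Field) : Represents (𝓕 (toDist u)) (freq u) := by
  rw [toDist, Lp.fourier_toTemperedDistribution_eq]
  exact represents_toTemperedDistribution _

theorem hDotNorm_sq {T : 𝓢'(V, VC)} {g : V → VC} (h : Represents (𝓕 T) g) (s : ℝ) :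
    hDotNorm s T ^ 2 = ∫⁻ ξ, ENNReal.ofReal ((2 * Real.pi * ‖ξ‖) ^ s) ^ 2 * ‖g ξ‖ₑ ^ 2 := by
  rw [hDotNorm_eq h, eLpNorm_two_sq]
  refine lintegral_congr fun ξ => ?_
  rw [enorm_smul, mul_pow, ← ofReal_norm (E := ℂ), Complex.norm_real,
    Real.norm_of_nonneg (by positivity)]

/-- Membership in `H¹` means that `(1 + |ξ|²)^{1/2} û` is square integrable. -/
theorem memSobolev_one_iff (u : Field) :
    TemperedDistribution.MemSobolev 1 2 (toDist u) ↔
      MemLp (fun ξ => (((1 + ‖ξ‖ ^ 2) ^ (1 / 2 : ℝ) : ℝ) : ℂ) • freq u ξ) 2 volume := by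
  have hm : (fun ξ : V => (((1 + ‖ξ‖ ^ 2) ^ (1 / 2 : ℝ) : ℝ) : ℂ)).HasTemperateGrowth :=
    Function.Complex.hasTemperateGrowth_ofReal.comp
      (Function.hasTemperateGrowth_one_add_norm_sq_rpow V (1 / 2))
  have hr := (represents_freq u).smulLeftCLM hm
  rw [TemperedDistribution.memSobolev_iff_exists_smulLeftCLM_fourier]
  constructor
  · rintro ⟨f, hf⟩
    rw [hf] at hr
    exact (memLp_congr_ae ((represents_toTemperedDistribution f).ae_eq hr)).1 (Lp.memLp f)
  · intro h
    refine ⟨h.toLp _, ?_⟩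
    ext1 ψ
    rw [(((represents_toTemperedDistribution (h.toLp _)).congr h.coeFn_toLp).2 ψ).2]
    exact (hr.2 ψ).2

theorem lintegral_norm_sq_mul_freq_lt_top {u : Field}
    (h : TemperedDistribution.MemSobolev 1 2 (toDist u)) :
    ∫⁻ ξ, ‖ξ‖ₑ ^ 2 * ‖freq u ξ‖ₑ ^ 2 < ⊤ := by
  have h1 := ((memSobolev_one_iff u).1 h).2
  have h2 := ENNReal.pow_lt_top (n := 2) h1
  rw [eLpNorm_two_sq] at h2
  refine lt_of_le_of_lt (lintegral_mono fun ξ => ?_) h2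
  rw [enorm_smul, mul_pow]
  gcongr
  rw [← ofReal_norm, ← ofReal_norm, Complex.norm_real, Real.norm_of_nonneg (by positivity),
    ← Real.sqrt_eq_rpow]
  exact ENNReal.ofReal_le_ofReal (Real.le_sqrt_of_sq_le (by linarith))

theorem hDotNorm_one_lt_top {u : Field} (h : TemperedDistribution.MemSobolev 1 2 (toDist u)) :
    hDotNorm 1 (toDist u) < ⊤ := by
  have h1 : hDotNorm 1 (toDist u) ^ 2 < ⊤ := by
    rw [hDotNorm_sq (represents_freq u)]
    simp only [Real.rpow_one]
    have e : ∀ ξ : V, ENNReal.ofReal (2 * Real.pi * ‖ξ‖) ^ 2 * ‖freq u ξ‖ₑ ^ 2 =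
        ENNReal.ofReal (2 * Real.pi) ^ 2 * (‖ξ‖ₑ ^ 2 * ‖freq u ξ‖ₑ ^ 2) := fun ξ => by
      rw [ENNReal.ofReal_mul (by positivity), ofReal_norm, mul_pow, mul_assoc]
    simp only [e]
    rw [lintegral_const_mul' _ _ (by finiteness)]
    exact ENNReal.mul_lt_top (by finiteness) (lintegral_norm_sq_mul_freq_lt_top h)
  by_contra hne
  rw [not_lt, top_le_iff] at hne
  simp [hne] at h1

/-- Interpolation: `‖u‖_{Ḣ^{1/2}}² ≤ ‖u‖_{L²} ‖u‖_{Ḣ¹}`. -/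
theorem lintegral_norm_mul_freq_le {u : Field}
    (h : TemperedDistribution.MemSobolev 1 2 (toDist u)) :
    ∫⁻ ξ, ‖ξ‖ₑ * ‖freq u ξ‖ₑ ^ 2 ≤
      ENNReal.ofReal (‖u‖ * (hDotNorm 1 (toDist u)).toReal) := by
  have hfin := hDotNorm_one_lt_top h
  have hm : AEMeasurable (fun ξ => ‖freq u ξ‖ₑ) volume := (Lp.aestronglyMeasurable _).enorm
  have key := ENNReal.lintegral_mul_norm_pow_le (μ := (volume : Measure V))
    (f := fun ξ => ‖freq u ξ‖ₑ ^ 2)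
    (g := fun ξ => ENNReal.ofReal ((2 * Real.pi * ‖ξ‖) ^ (1 : ℝ)) ^ 2 * ‖freq u ξ‖ₑ ^ 2)
    (hm.pow_const 2) (by fun_prop) (p := 1 / 2) (q := 1 / 2)
    (by norm_num) (by norm_num) (by norm_num)
  rw [← hDotNorm_sq (represents_freq u) 1, lintegral_freq_sq] at key
  have half : ∀ x : ℝ≥0∞, (x ^ 2) ^ (1 / 2 : ℝ) = x := fun x => by
    rw [← ENNReal.rpow_natCast, ← ENNReal.rpow_mul]
    norm_num
  rw [half, ENNReal.ofReal_pow (norm_nonneg _), half] at key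
  rw [ENNReal.ofReal_mul (norm_nonneg _), ENNReal.ofReal_toReal hfin.ne]
  refine le_trans (lintegral_mono fun ξ => ?_) key
  simp only [Real.rpow_one]
  rw [← mul_pow, half, half]
  calc ‖ξ‖ₑ * ‖freq u ξ‖ₑ ^ 2
      ≤ ENNReal.ofReal (2 * Real.pi * ‖ξ‖) * ‖freq u ξ‖ₑ ^ 2 := by
        gcongr
        rw [← ofReal_norm]
        refine ENNReal.ofReal_le_ofReal (le_mul_of_one_le_left (norm_nonneg _) ?_)
        linarith [Real.pi_gt_three]
    _ = _ := by ring

/-- The horizontal part of `2πi ξ × w`, the Fourier transform of the horizontal vorticity. -/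
def curlHat (ξ : V) (w : VC) : VC :=
  (2 * Real.pi * Complex.I) • WithLp.toLp 2
    ![(ξ 1 : ℂ) * w 2 - ξ 2 * w 1, (ξ 2 : ℂ) * w 0 - ξ 0 * w 2, 0]

theorem fourier_partialDeriv_apply (u : Field) (i k : Fin 3) (ψ : 𝓢(V, ℂ)) :
    Integrable (fun ξ => ψ ξ * (2 * Real.pi * Complex.I * (ξ i * freq u ξ k))) volume ∧
      partialDeriv i (component k (toDist u)) (𝓕 ψ) =
        ∫ ξ, ψ ξ * (2 * Real.pi * Complex.I * (ξ i * freq u ξ k)) := by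
  have hm : (fun ξ : V => ((inner ℝ ξ (EuclideanSpace.single i (1 : ℝ)) : ℝ) : ℂ)).HasTemperateGrowth :=
    by fun_prop
  obtain ⟨h1, h2⟩ := (represents_freq u).2
    (SchwartzMap.smulLeftCLM ℂ (fun ξ : V =>
      ((inner ℝ ξ (EuclideanSpace.single i (1 : ℝ)) : ℝ) : ℂ)) ψ)
  have h3 := (EuclideanSpace.proj k : VC →L[ℂ] ℂ).integrable_comp h1
  have h4 := (EuclideanSpace.proj k : VC →L[ℂ] ℂ).integral_comp_comm h1
  have e : ∀ ξ, ψ ξ * (2 * Real.pi * Complex.I * (ξ i * freq u ξ k)) =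
      (2 * Real.pi * Complex.I) * (EuclideanSpace.proj k : VC →L[ℂ] ℂ)
        (SchwartzMap.smulLeftCLM ℂ (fun ξ : V =>
      ((inner ℝ ξ (EuclideanSpace.single i (1 : ℝ)) : ℝ) : ℂ)) ψ ξ • freq u ξ) := fun ξ => by
    rw [SchwartzMap.smulLeftCLM_apply_apply hm]
    simp [EuclideanSpace.inner_single_right]
    ring
  simp only [e]
  refine ⟨h3.const_mul _, ?_⟩
  rw [integral_const_mul, h4, ← h2]
  have h5 := congrArg (fun S : 𝓢'(V, ℂ) => S ψ) (TemperedDistribution.fourier_lineDerivOp_eq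
    (component k (toDist u)) (EuclideanSpace.single i (1 : ℝ)))
  exact h5

theorem represents_curlHat (u : Field) :
    Represents (𝓕 (horizontal (curl (toDist u)))) (fun ξ => curlHat ξ (freq u ξ)) := by
  have hcomp : ∀ (φ : 𝓢(V, ℂ)) (i : Fin 3), (horizontal (curl (toDist u)) φ) i =
      ![partialDeriv 1 (component 2 (toDist u)) φ - partialDeriv 2 (component 1 (toDist u)) φ,
        partialDeriv 2 (component 0 (toDist u)) φ - partialDeriv 0 (component 2 (toDist u)) φ,
        0] i := fun φ i => by
    have h := congrArg (fun S : 𝓢'(V, ℂ) => S φ) (component_ofComponents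
      ![component 0 (curl (toDist u)), component 1 (curl (toDist u)), 0] i)
    refine Eq.trans h ?_
    fin_cases i
    · exact congrArg (fun S : 𝓢'(V, ℂ) => S φ) (component_ofComponents _ 0)
    · exact congrArg (fun S : 𝓢'(V, ℂ) => S φ) (component_ofComponents _ 1)
    · rfl
  have hmeas : ∀ i, AEStronglyMeasurable (fun ξ => freq u ξ i) volume := fun i =>
    (EuclideanSpace.proj i : VC →L[ℂ] ℂ).continuous.comp_aestronglyMeasurable
      (Lp.aestronglyMeasurable (freq u))
  have hint : ∀ ψ : 𝓢(V, ℂ), ∀ i,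
      Integrable (fun ξ => (ψ ξ • curlHat ξ (freq u ξ)) i) volume ∧
      (horizontal (curl (toDist u)) (𝓕 ψ)) i = ∫ ξ, (ψ ξ • curlHat ξ (freq u ξ)) i := by
    intro ψ i
    rw [hcomp]
    have H := fun i k => fourier_partialDeriv_apply u i k ψ
    fin_cases i
    · have e : ∀ ξ, (ψ ξ • curlHat ξ (freq u ξ)) 0 =
        ψ ξ * (2 * Real.pi * Complex.I * (ξ 1 * freq u ξ 2)) -
        ψ ξ * (2 * Real.pi * Complex.I * (ξ 2 * freq u ξ 1)) := fun ξ => by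
        simp [curlHat]; ring
      simp only [Fin.zero_eta, e]
      refine ⟨(H 1 2).1.sub (H 2 1).1, ?_⟩
      rw [integral_sub (H 1 2).1 (H 2 1).1, ← (H 1 2).2, ← (H 2 1).2]
      rfl
    · have e : ∀ ξ, (ψ ξ • curlHat ξ (freq u ξ)) 1 =
        ψ ξ * (2 * Real.pi * Complex.I * (ξ 2 * freq u ξ 0)) -
        ψ ξ * (2 * Real.pi * Complex.I * (ξ 0 * freq u ξ 2)) := fun ξ => by
        simp [curlHat]; ring
      simp only [Fin.mk_one, e]
      refine ⟨(H 2 0).1.sub (H 0 2).1, ?_⟩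
      rw [integral_sub (H 2 0).1 (H 0 2).1, ← (H 2 0).2, ← (H 0 2).2]
      rfl
    · have e : ∀ ξ, (ψ ξ • curlHat ξ (freq u ξ)) 2 = 0 := fun ξ => by
        simp [curlHat]
      simp only [Fin.reduceFinMk, e]
      simp
  have hvec : ∀ ψ : 𝓢(V, ℂ), Integrable (fun ξ => ψ ξ • curlHat ξ (freq u ξ)) volume := fun ψ =>
    Integrable.of_eval_piLp fun i => (hint ψ i).1
  refine ⟨?_, fun ψ => ⟨hvec ψ, ?_⟩⟩
  · have h0 := hmeas 0
    have h1 := hmeas 1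
    have h2 := hmeas 2
    have hco : ∀ i, AEStronglyMeasurable (fun ξ : V => (ξ i : ℂ)) volume := fun i =>
      (by fun_prop : Continuous fun ξ : V => (ξ i : ℂ)).aestronglyMeasurable
    refine AEStronglyMeasurable.const_smul (f := fun ξ : V => (WithLp.toLp 2
      ![(ξ 1 : ℂ) * freq u ξ 2 - ξ 2 * freq u ξ 1, (ξ 2 : ℂ) * freq u ξ 0 - ξ 0 * freq u ξ 2, 0] :
        VC)) ?_ (2 * Real.pi * Complex.I)
    refine (PiLp.continuous_toLp 2 (fun _ : Fin 3 => ℂ)).comp_aestronglyMeasurable ?_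
    refine (aemeasurable_pi_iff.2 fun i => AEStronglyMeasurable.aemeasurable ?_).aestronglyMeasurable
    fin_cases i
    · exact ((hco 1).mul h2).sub ((hco 2).mul h1)
    · exact ((hco 2).mul h0).sub ((hco 0).mul h2)
    · exact aestronglyMeasurable_const
  · ext i
    rw [TemperedDistribution.fourier_apply, (hint ψ i).2, eval_integral_piLp]
    exact fun i => (hint ψ i).1

/-! ### Almost two-dimensional fields are small in the anisotropic norm -/

theorem norm_sq_curlHat (ξ : V) (w : VC) :
    ‖curlHat ξ w‖ ^ 2 = (2 * Real.pi) ^ 2 *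
      (‖(ξ 1 : ℂ) * w 2 - ξ 2 * w 1‖ ^ 2 + ‖(ξ 2 : ℂ) * w 0 - ξ 0 * w 2‖ ^ 2) := by
  rw [curlHat, norm_smul, mul_pow, EuclideanSpace.norm_sq_eq, Fin.sum_univ_three]
  simp [abs_of_pos Real.pi_pos]

/-- For divergence-free fields, `|ξ₃| |û|` is controlled by the horizontal vorticity. -/
theorem norm_sq_curlHat_ge {ξ : V} {w : VC} (h : ∑ i, ((ξ i : ℝ) : ℂ) * w i = 0) :
    (2 * Real.pi) ^ 2 * (ξ 2 * ‖w‖) ^ 2 ≤ ‖curlHat ξ w‖ ^ 2 := by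
  have hreal : ∀ x y z p q r : ℝ, x * p + y * q + z * r = 0 →
      z ^ 2 * (p ^ 2 + q ^ 2 + r ^ 2) ≤ (y * r - z * q) ^ 2 + (z * p - x * r) ^ 2 := by
    intro x y z p q r h
    have e : (y * r - z * q) ^ 2 + (z * p - x * r) ^ 2 - z ^ 2 * (p ^ 2 + q ^ 2 + r ^ 2) =
        r ^ 2 * (x ^ 2 + y ^ 2 + z ^ 2) := by
      linear_combination (-2 * z * r) * h
    have : 0 ≤ r ^ 2 * (x ^ 2 + y ^ 2 + z ^ 2) := by positivity
    linarith
  rw [Fin.sum_univ_three] at h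
  have hre := congrArg Complex.re h
  have him := congrArg Complex.im h
  simp at hre him
  have h1 := hreal _ _ _ _ _ _ hre
  have h2 := hreal _ _ _ _ _ _ him
  rw [norm_sq_curlHat]
  refine mul_le_mul_of_nonneg_left ?_ (by positivity)
  rw [mul_pow, EuclideanSpace.norm_sq_eq, Fin.sum_univ_three]
  simp only [Complex.sq_norm, Complex.normSq_apply]
  simp
  nlinarith

theorem norm_sq_curlHat_le (ξ : V) (w : VC) :
    ‖curlHat ξ w‖ ^ 2 ≤ (2 * Real.pi) ^ 2 * (4 * ‖ξ‖ ^ 2 * ‖w‖ ^ 2) := by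
  rw [norm_sq_curlHat]
  have hc : ∀ i k l m : Fin 3, ‖(ξ i : ℂ) * w k - ξ l * w m‖ ^ 2 ≤
      2 * ((ξ i ^ 2) * ‖w k‖ ^ 2) + 2 * ((ξ l ^ 2) * ‖w m‖ ^ 2) := fun i k l m => by
    have h1 := norm_sub_le ((ξ i : ℂ) * w k) (ξ l * w m)
    rw [norm_mul, norm_mul, Complex.norm_real, Complex.norm_real, Real.norm_eq_abs,
      Real.norm_eq_abs] at h1
    have h2 : ‖(ξ i : ℂ) * w k - ξ l * w m‖ ^ 2 ≤ (|ξ i| * ‖w k‖ + |ξ l| * ‖w m‖) ^ 2 := by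
      gcongr
    rw [← sq_abs (ξ i), ← sq_abs (ξ l)]
    nlinarith [sq_nonneg (|ξ i| * ‖w k‖ - |ξ l| * ‖w m‖)]
  have h1 := hc 1 2 2 1
  have h2 := hc 2 0 0 2
  rw [EuclideanSpace.norm_sq_eq, EuclideanSpace.norm_sq_eq, Fin.sum_univ_three,
    Fin.sum_univ_three]
  simp only [Real.norm_eq_abs, sq_abs]
  refine mul_le_mul_of_nonneg_left ?_ (by positivity)
  nlinarith [sq_nonneg (ξ 0), sq_nonneg (ξ 1), sq_nonneg (ξ 2), sq_nonneg ‖w 0‖,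
    sq_nonneg ‖w 1‖, sq_nonneg ‖w 2‖,
    mul_nonneg (sq_nonneg (ξ 0)) (sq_nonneg ‖w 0‖), mul_nonneg (sq_nonneg (ξ 0)) (sq_nonneg ‖w 1‖),
    mul_nonneg (sq_nonneg (ξ 0)) (sq_nonneg ‖w 2‖), mul_nonneg (sq_nonneg (ξ 1)) (sq_nonneg ‖w 0‖),
    mul_nonneg (sq_nonneg (ξ 1)) (sq_nonneg ‖w 1‖), mul_nonneg (sq_nonneg (ξ 1)) (sq_nonneg ‖w 2‖),
    mul_nonneg (sq_nonneg (ξ 2)) (sq_nonneg ‖w 0‖), mul_nonneg (sq_nonneg (ξ 2)) (sq_nonneg ‖w 1‖),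
    mul_nonneg (sq_nonneg (ξ 2)) (sq_nonneg ‖w 2‖)]

theorem rpow_neg_half_sq {x : ℝ} (hx : 0 ≤ x) : (x ^ (-1 / 2 : ℝ)) ^ 2 = x⁻¹ := by
  rw [← Real.rpow_natCast, ← Real.rpow_mul hx]
  norm_num [Real.rpow_neg_one]

/-- The horizontal vorticity of an `H¹` field has finite `Ḣ^{-1/2}` norm. -/
theorem hDotNorm_vorticity_lt_top {u : Field}
    (h : TemperedDistribution.MemSobolev 1 2 (toDist u)) :
    hDotNorm (-1 / 2) (horizontal (curl (toDist u))) < ⊤ := by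
  have h1 : hDotNorm (-1 / 2) (horizontal (curl (toDist u))) ^ 2 < ⊤ := by
    rw [hDotNorm_sq (represents_curlHat u)]
    have hle : ∀ ξ, ENNReal.ofReal ((2 * Real.pi * ‖ξ‖) ^ (-1 / 2 : ℝ)) ^ 2 *
        ‖curlHat ξ (freq u ξ)‖ₑ ^ 2 ≤
        ENNReal.ofReal (8 * Real.pi) * (‖ξ‖ₑ * ‖freq u ξ‖ₑ ^ 2) := fun ξ => by
      simp only [← ofReal_norm, ← ENNReal.ofReal_pow (norm_nonneg _)]
      rw [← ENNReal.ofReal_pow (by positivity), rpow_neg_half_sq (by positivity),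
        ← ENNReal.ofReal_mul (by positivity), ← ENNReal.ofReal_mul (by positivity),
        ← ENNReal.ofReal_mul (by positivity)]
      refine ENNReal.ofReal_le_ofReal ?_
      rcases (norm_nonneg ξ).eq_or_lt with h0 | h0
      · rw [← h0]; simp
      · refine (mul_le_mul_of_nonneg_left (norm_sq_curlHat_le ξ (freq u ξ))
          (by positivity)).trans (le_of_eq ?_)
        field_simp
        ring
    refine lt_of_le_of_lt (lintegral_mono hle) ?_
    rw [lintegral_const_mul' _ _ (by finiteness)]
    exact ENNReal.mul_lt_top (by finiteness)
      (lt_of_le_of_lt (lintegral_norm_mul_freq_le h) ENNReal.ofReal_lt_top)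
  by_contra hne
  rw [not_lt, top_le_iff] at hne
  simp [hne] at h1

theorem weight_le (ξ : V) : weight ξ ≤ ‖ξ‖ ^ (2 / 3 : ℝ) * |ξ 2| ^ (1 / 3 : ℝ) := by
  have h : ∀ i, |ξ i| ≤ ‖ξ‖ := fun i => by
    simpa using PiLp.norm_apply_le ξ i
  have e : ‖ξ‖ ^ (2 / 3 : ℝ) = ‖ξ‖ ^ (1 / 3 : ℝ) * ‖ξ‖ ^ (1 / 3 : ℝ) := by
    rw [← Real.rpow_add_of_nonneg (norm_nonneg _) (by norm_num) (by norm_num)]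
    norm_num
  rw [weight, Fin.prod_univ_three, e]
  gcongr
  · exact h 0
  · exact h 1

/-- The interpolation `weight ≤ (ξ₃² / |ξ|)^{1/6} |ξ|^{5/6}` between the horizontal vorticity in
`Ḣ^{-1/2}` and the velocity in `Ḣ^{1/2}`. -/
theorem lintegral_weight_mul_freq_le {u : Field} (h : MemH1df u) {A N : ℝ} (hA : 0 ≤ A)
    (hN : 0 ≤ N) (hAu : hDotNorm (-1 / 2) (horizontal (curl (toDist u))) ≤ ENNReal.ofReal A)
    (hNu : ∫⁻ ξ, ‖ξ‖ₑ * ‖freq u ξ‖ₑ ^ 2 ≤ ENNReal.ofReal (N ^ 2)) :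
    ∫⁻ ξ, ENNReal.ofReal (weight ξ) * ‖freq u ξ‖ₑ ^ 2 ≤
      ENNReal.ofReal ((A ^ (1 / 6 : ℝ) * N ^ (5 / 6 : ℝ)) ^ 2) := by
  have hm : AEMeasurable (fun ξ => ‖freq u ξ‖ₑ) volume := (Lp.aestronglyMeasurable _).enorm
  have hmc : AEMeasurable (fun ξ => ‖curlHat ξ (freq u ξ)‖ₑ) volume :=
    (represents_curlHat u).1.enorm
  have key := ENNReal.lintegral_mul_norm_pow_le (μ := (volume : Measure V))
    (f := fun ξ => ENNReal.ofReal ((2 * Real.pi * ‖ξ‖) ^ (-1 / 2 : ℝ)) ^ 2 *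
      ‖curlHat ξ (freq u ξ)‖ₑ ^ 2)
    (g := fun ξ => ‖ξ‖ₑ * ‖freq u ξ‖ₑ ^ 2)
    (by fun_prop) (by fun_prop) (p := 1 / 6) (q := 5 / 6) (by norm_num) (by norm_num) (by norm_num)
  rw [← hDotNorm_sq (represents_curlHat u)] at key
  calc _ ≤ _ := lintegral_mono_ae ?_
    _ ≤ _ := key
    _ ≤ ENNReal.ofReal (A ^ 2) ^ (1 / 6 : ℝ) * ENNReal.ofReal (N ^ 2) ^ (5 / 6 : ℝ) := by
        rw [ENNReal.ofReal_pow hA]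
        gcongr
    _ = _ := by
        rw [ENNReal.ofReal_rpow_of_nonneg (by positivity) (by norm_num),
          ENNReal.ofReal_rpow_of_nonneg (by positivity) (by norm_num),
          ← ENNReal.ofReal_mul (by positivity), mul_pow, ← Real.rpow_natCast A,
          ← Real.rpow_natCast N, ← Real.rpow_natCast (A ^ _), ← Real.rpow_natCast (N ^ _),
          ← Real.rpow_mul hA, ← Real.rpow_mul hA, ← Real.rpow_mul hN, ← Real.rpow_mul hN,
          mul_comm (1 / 6 : ℝ), mul_comm (5 / 6 : ℝ)]
  filter_upwards [ae_weight_pos, h.2] with ξ hξ hdiv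
  have hr : 0 < ‖ξ‖ := by
    rw [norm_pos_iff]
    rintro rfl
    simp [weight] at hξ
  have hge := norm_sq_curlHat_ge hdiv
  set n := ‖freq u ξ‖ with hn
  have hn0 : 0 ≤ n := norm_nonneg _
  have hF : |ξ 2| ^ 2 * ‖ξ‖⁻¹ * n ^ 2 ≤
      (2 * Real.pi * ‖ξ‖)⁻¹ * ‖curlHat ξ (freq u ξ)‖ ^ 2 := by
    calc |ξ 2| ^ 2 * ‖ξ‖⁻¹ * n ^ 2 ≤ (2 * Real.pi) * (|ξ 2| ^ 2 * ‖ξ‖⁻¹ * n ^ 2) :=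
          le_mul_of_one_le_left (by positivity) (by linarith [Real.pi_gt_three])
      _ = (2 * Real.pi * ‖ξ‖)⁻¹ * ((2 * Real.pi) ^ 2 * (ξ 2 * n) ^ 2) := by
          rw [sq_abs]
          field_simp
      _ ≤ _ := mul_le_mul_of_nonneg_left hge (by positivity)
  simp only [← ofReal_norm, ← ENNReal.ofReal_pow (norm_nonneg _)]
  rw [← ENNReal.ofReal_pow (by positivity), rpow_neg_half_sq (by positivity),
    ← ENNReal.ofReal_mul (weight_nonneg ξ), ← ENNReal.ofReal_mul (by positivity),
    ← ENNReal.ofReal_mul (by positivity),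
    ENNReal.ofReal_rpow_of_nonneg (by positivity) (by norm_num),
    ENNReal.ofReal_rpow_of_nonneg (by positivity) (by norm_num),
    ← ENNReal.ofReal_mul (by positivity)]
  refine ENNReal.ofReal_le_ofReal ?_
  calc weight ξ * n ^ 2 ≤ ‖ξ‖ ^ (2 / 3 : ℝ) * |ξ 2| ^ (1 / 3 : ℝ) * n ^ 2 := by
        gcongr
        exact weight_le ξ
    _ = (|ξ 2| ^ 2 * ‖ξ‖⁻¹ * n ^ 2) ^ (1 / 6 : ℝ) * (‖ξ‖ * n ^ 2) ^ (5 / 6 : ℝ) := by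
        have e1 : (n ^ 2) ^ (1 / 6 : ℝ) * (n ^ 2) ^ (5 / 6 : ℝ) = n ^ 2 := by
          rw [← Real.rpow_add_of_nonneg (by positivity) (by norm_num) (by norm_num)]
          norm_num
        have e2 : (|ξ 2| ^ 2) ^ (1 / 6 : ℝ) = |ξ 2| ^ (1 / 3 : ℝ) := by
          rw [← Real.rpow_natCast, ← Real.rpow_mul (abs_nonneg _)]
          norm_num
        have e3 : (‖ξ‖⁻¹) ^ (1 / 6 : ℝ) * ‖ξ‖ ^ (5 / 6 : ℝ) = ‖ξ‖ ^ (2 / 3 : ℝ) := by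
          rw [Real.inv_rpow hr.le, ← Real.rpow_neg hr.le, ← Real.rpow_add hr]
          norm_num
        rw [Real.mul_rpow (by positivity) (by positivity),
          Real.mul_rpow (by positivity) (by positivity),
          Real.mul_rpow (by positivity) (by positivity), e2]
        linear_combination (-(|ξ 2| ^ (1 / 3 : ℝ) * (‖ξ‖⁻¹ ^ (1 / 6 : ℝ) * ‖ξ‖ ^ (5 / 6 : ℝ)))) * e1
          - (|ξ 2| ^ (1 / 3 : ℝ) * n ^ 2) * e3
    _ ≤ _ := by gcongr

theorem one_add_mul_exp_neg_mul_sq_le {k : ℝ} (hk : 0 < k) (z : ℝ) :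
    (1 + z) * Real.exp (-(k * z ^ 2)) ≤ 2 + k⁻¹ := by
  have h1 : Real.exp (-(k * z ^ 2)) ≤ 1 := Real.exp_le_one_iff.2 (by
    have : 0 ≤ k * z ^ 2 := by positivity
    linarith)
  have h2 : z ^ 2 * Real.exp (-(k * z ^ 2)) ≤ k⁻¹ := by
    rw [Real.exp_neg, ← div_eq_mul_inv, div_le_iff₀ (Real.exp_pos _)]
    have h3 := Real.add_one_le_exp (k * z ^ 2)
    calc z ^ 2 = k⁻¹ * (k * z ^ 2) := by field_simp
      _ ≤ k⁻¹ * Real.exp (k * z ^ 2) := by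
        gcongr
        linarith
  have h3 : (1 + z) * Real.exp (-(k * z ^ 2)) ≤ (2 + z ^ 2) * Real.exp (-(k * z ^ 2)) := by
    refine mul_le_mul_of_nonneg_right ?_ (Real.exp_pos _).le
    nlinarith [sq_nonneg (z - 1)]
  linarith

theorem R₁_pos : 0 < R₁ := by unfold R₁; positivity

theorem R₂_pos : 0 < R₂ := by unfold R₂; positivity

/-- The horizontal vorticity enters the bound of `exists_besovNorm_le` with a positive power, and on
`Γ_2d` it decays like a Gaussian in `‖u‖_{L²} ‖u‖_{Ḣ¹}`; this compensates the growth of the factor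
`‖u‖_{Ḣ^{1/2}}`. -/
theorem exists_besovNorm_Gamma2d_le {ν : ℝ} (hν : 0 < ν) (P : DyadicPartition) {p : ℝ≥0∞}
    (hp : 2 < p) :
    ∃ C : ℝ≥0, ∀ u ∈ Gamma2d ν, besovNorm P (-1 + (3 / p).toReal) p (toDist u) ≤ C := by
  obtain ⟨C₀, hC₀, hbd⟩ := exists_besovNorm_le P hp
  have hR₁ := R₁_pos
  have hR₂ := R₂_pos
  -- the weighted norm enters with the exponent `1 - 2 / p`, which is positive
  have he : 2 / p.toReal < 1 := by
    rcases eq_or_ne p ⊤ with rfl | hpt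
    · simp
    · have h2 : 2 < p.toReal := by
        have := (ENNReal.toReal_lt_toReal ENNReal.ofNat_ne_top hpt).2 hp
        simpa using this
      rw [div_lt_one (by linarith)]
      exact h2
  set d := 2 / p.toReal with hd
  have hd0 : 0 ≤ d := by positivity
  set a := (1 - d) / 6 with ha
  have ha0 : 0 < a := by rw [ha]; linarith
  set D := R₁ * ν * Real.exp (6912 * Real.pi ^ 4 * ν ^ 4 / (R₂ * ν ^ 3)) with hD
  set k := 1 / (4 * (R₂ * ν ^ 3)) with hk
  have hD0 : 0 < D := by positivity
  have hk0 : 0 < k := by positivity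
  refine ⟨(C₀ * (D ^ a * (2 + (k * a)⁻¹))).toNNReal, fun u hu => ?_⟩
  obtain ⟨hmem, hlt⟩ := hu
  set A₀ := (hDotNorm (-1 / 2) (horizontal (curl (toDist u)))).toReal with hA₀
  set H := (hDotNorm 1 (toDist u)).toReal with hH
  have hH0 : 0 ≤ H := ENNReal.toReal_nonneg
  -- `z` bounds the square of the `Ḣ^{1/2}` norm and `A` the norm of the horizontal vorticity
  set z := ‖u‖ * H with hz
  have hz0 : 0 ≤ z := by positivity
  set A := D * Real.exp (-(k * z ^ 2)) with hA
  have hApos : 0 < A := by positivity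
  have hAle : A₀ ≤ A := by
    have h1 : A = R₁ * ν / Real.exp ((1 / 4 * ‖u‖ ^ 2 * H ^ 2 - 6912 * Real.pi ^ 4 * ν ^ 4) /
        (R₂ * ν ^ 3)) := by
      rw [hA, hD, mul_assoc, ← Real.exp_add, div_eq_mul_inv (R₁ * ν), ← Real.exp_neg, hk, hz]
      congr 2
      field_simp
      ring
    rw [h1, le_div_iff₀ (Real.exp_pos _)]
    exact hlt.le
  set N := Real.sqrt (1 + z) with hN
  have hN0 : 0 < N := Real.sqrt_pos.2 (by linarith)
  have hNu : ∫⁻ ξ, ‖ξ‖ₑ * ‖freq u ξ‖ₑ ^ 2 ≤ ENNReal.ofReal (N ^ 2) := by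
    refine (lintegral_norm_mul_freq_le hmem.1).trans (ENNReal.ofReal_le_ofReal ?_)
    rw [hN, Real.sq_sqrt (by linarith)]
    linarith
  have hAu : hDotNorm (-1 / 2) (horizontal (curl (toDist u))) ≤ ENNReal.ofReal A := by
    rw [← ENNReal.ofReal_toReal (hDotNorm_vorticity_lt_top hmem.1).ne]
    exact ENNReal.ofReal_le_ofReal hAle
  refine (hbd u (A ^ (1 / 6 : ℝ) * N ^ (5 / 6 : ℝ)) N (by positivity) hN0.le
    (lintegral_weight_mul_freq_le hmem hApos.le hN0.le hAu hNu) hNu).trans ?_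
  change ENNReal.ofReal _ ≤ ENNReal.ofReal _
  refine ENNReal.ofReal_le_ofReal (mul_le_mul_of_nonneg_left ?_ hC₀)
  calc (A ^ (1 / 6 : ℝ) * N ^ (5 / 6 : ℝ)) ^ (1 - d) * N ^ d
      = A ^ a * N ^ (1 - a) := by
        rw [Real.mul_rpow (by positivity) (by positivity), ← Real.rpow_mul hApos.le,
          ← Real.rpow_mul hN0.le, mul_assoc, ← Real.rpow_add hN0, ha]
        congr 2 <;> ring
    _ = D ^ a * (N ^ (1 - a) * Real.exp (-(k * a * z ^ 2))) := by
        rw [hA, Real.mul_rpow hD0.le (Real.exp_pos _).le, ← Real.exp_mul,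
          show -(k * z ^ 2) * a = -(k * a * z ^ 2) by ring]
        ring
    _ ≤ D ^ a * ((1 + z) * Real.exp (-(k * a * z ^ 2))) := by
        gcongr
        have h1 : 1 ≤ N := Real.one_le_sqrt.2 (by linarith)
        calc N ^ (1 - a) ≤ N ^ (2 : ℝ) := Real.rpow_le_rpow_of_exponent_le h1 (by linarith)
          _ = 1 + z := by rw [Real.rpow_two, hN, Real.sq_sqrt (by linarith)]
    _ ≤ _ := by
        gcongr
        exact one_add_mul_exp_neg_mul_sq_le (by positivity) z

/-! ### Real fields with prescribed Fourier transform -/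

open ComplexConjugate in
theorem conj_fourierInv_eq {g : V → VC} (hg : Integrable g volume)
    (hs : ∀ ξ i, g (-ξ) i = conj (g ξ i)) (x : V) (i : Fin 3) :
    conj (𝓕⁻ g x i) = 𝓕⁻ g x i := by
  have hi : Integrable (fun v => Real.fourierChar (inner ℝ v x) • g v) volume := by
    have := (VectorFourier.fourierIntegral_convergent_iff (μ := (volume : Measure V))
      (L := -innerₗ V) Real.continuous_fourierChar
      (continuous_inner (𝕜 := ℝ) (E := V)).neg x).2 hg
    simpa using this
  have hc : 𝓕⁻ g x i = ∫ v, (Real.fourierChar (inner ℝ v x) : ℂ) * g v i := by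
    rw [Real.fourierInv_eq, eval_integral_piLp (fun i => Integrable.eval_piLp hi i)]
    rfl
  rw [hc, ← integral_conj, ← integral_neg_eq_self]
  refine integral_congr_ae (Filter.Eventually.of_forall fun v => ?_)
  simp only [map_mul, hs, inner_neg_left, AddChar.map_neg_eq_inv, Circle.coe_inv_eq_conj,
    Complex.conj_conj]

open ComplexConjugate in
/-- An integrable and square integrable function `g` with the symmetry `g(-ξ) = conj g(ξ)` is the
Fourier transform of a real vector field. -/
theorem exists_field_freq_eq {g : V → VC} (hg : Integrable g volume) (hg2 : MemLp g 2 volume)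
    (hs : ∀ ξ i, g (-ξ) i = conj (g ξ i)) : ∃ u : Field, freq u = hg2.toLp g := by
  have hi : Integrable ((hg2.toLp g : L2C) : V → VC) volume := hg.congr hg2.coeFn_toLp.symm
  have he : ((𝓕⁻ (hg2.toLp g) : L2C) : V → VC) =ᵐ[volume] 𝓕⁻ g := by
    refine (fourierInv_ae_eq _ hi).trans (Filter.Eventually.of_forall fun x => ?_)
    simp only [Real.fourierInv_eq]
    refine integral_congr_ae ?_
    filter_upwards [hg2.coeFn_toLp] with v hv
    rw [hv]
  have hk : MemLp (𝓕⁻ g) 2 volume := (memLp_congr_ae he).1 (Lp.memLp _)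
  let re : VC → V := fun w => WithLp.toLp 2 fun i => (w i).re
  have hrec : Continuous re := by fun_prop
  have hrek : MemLp (fun x => re (𝓕⁻ g x)) 2 volume := by
    refine hk.of_le (hrec.comp_aestronglyMeasurable hk.1) (Filter.Eventually.of_forall fun x => ?_)
    rw [EuclideanSpace.norm_eq, EuclideanSpace.norm_eq]
    refine Real.sqrt_le_sqrt (Finset.sum_le_sum fun i _ => ?_)
    gcongr
    exact Complex.abs_re_le_norm _
  refine ⟨hrek.toLp _, ?_⟩
  have hu : toComplex (hrek.toLp _) = 𝓕⁻ (hg2.toLp g) := by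
    refine Lp.ext ?_
    filter_upwards [complexify.coeFn_compLp (hrek.toLp _), hrek.coeFn_toLp, he] with x h1 h2 h3
    rw [toComplex, h1, h2, h3]
    ext i
    exact Complex.conj_eq_iff_re.1 (conj_fourierInv_eq hg hs x i)
  rw [freq, hu, FourierTransform.fourier_fourierInv_eq]

theorem hDotNorm_le_of_ae_le {T : 𝓢'(V, VC)} {g : V → VC} (h : Represents (𝓕 T) g) {s c : ℝ}
    {u : Field} (hc : 0 ≤ c) (hle : ∀ᵐ ξ, (2 * Real.pi * ‖ξ‖) ^ s * ‖g ξ‖ ≤ c * ‖freq u ξ‖) :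
    hDotNorm s T ≤ ENNReal.ofReal (c * ‖u‖) := by
  rw [← ENNReal.pow_le_pow_left_iff two_ne_zero, hDotNorm_sq h,
    ← ENNReal.ofReal_pow (by positivity), mul_pow, ENNReal.ofReal_mul (by positivity),
    ← lintegral_freq_sq, ← lintegral_const_mul' _ _ ENNReal.ofReal_ne_top]
  refine lintegral_mono_ae ?_
  filter_upwards [hle] with ξ hξ
  rw [ENNReal.ofReal_pow hc, ← mul_pow, ← mul_pow, ← ofReal_norm, ← ofReal_norm,
    ← ENNReal.ofReal_mul (by positivity), ← ENNReal.ofReal_mul hc]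
  gcongr

theorem le_hDotNorm_of_ae_le {T : 𝓢'(V, VC)} {g : V → VC} (h : Represents (𝓕 T) g) {s : ℝ}
    {u : Field} (hle : ∀ᵐ ξ, ‖freq u ξ‖ ≤ (2 * Real.pi * ‖ξ‖) ^ s * ‖g ξ‖) :
    ENNReal.ofReal ‖u‖ ≤ hDotNorm s T := by
  rw [← ENNReal.pow_le_pow_left_iff two_ne_zero, hDotNorm_sq h,
    ← ENNReal.ofReal_pow (by positivity), ← lintegral_freq_sq]
  refine lintegral_mono_ae ?_
  filter_upwards [hle] with ξ hξ
  rw [← mul_pow, ← ofReal_norm, ← ofReal_norm, ← ENNReal.ofReal_mul (by positivity)]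
  gcongr

/-! ### Fields concentrated near the horizontal frequency plane -/

/-- The thin frequency annulus `1 ≤ |ξ_h| ≤ 2`, `|ξ₃| ≤ ε`. -/
def slab (ε : ℝ) : Set V := {ξ | 1 ≤ ξ 0 ^ 2 + ξ 1 ^ 2 ∧ ξ 0 ^ 2 + ξ 1 ^ 2 ≤ 4 ∧ |ξ 2| ≤ ε}

theorem measurableSet_slab (ε : ℝ) : MeasurableSet (slab ε) := by
  have h1 : Measurable fun ξ : V => ξ 0 ^ 2 + ξ 1 ^ 2 := by fun_prop
  have h2 : Measurable fun ξ : V => |ξ 2| := by fun_prop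
  exact (measurableSet_le measurable_const h1).inter
    ((measurableSet_le h1 measurable_const).inter (measurableSet_le h2 measurable_const))

theorem norm_of_mem_slab {ε : ℝ} (hε : ε ≤ 1) {ξ : V} (h : ξ ∈ slab ε) :
    1 ≤ ‖ξ‖ ∧ ‖ξ‖ ≤ 3 := by
  obtain ⟨h1, h2, h3⟩ := h
  have h4 : ξ 2 ^ 2 ≤ 1 := by
    rw [sq_le_one_iff_abs_le_one]
    exact h3.trans hε
  have e : ‖ξ‖ ^ 2 = ξ 0 ^ 2 + ξ 1 ^ 2 + ξ 2 ^ 2 := by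
    rw [EuclideanSpace.norm_sq_eq, Fin.sum_univ_three]
    simp
  constructor
  · nlinarith [sq_nonneg (ξ 2), norm_nonneg ξ]
  · nlinarith [norm_nonneg ξ]

theorem volume_slab_pos {ε : ℝ} (hε : 0 < ε) : 0 < volume (slab ε) := by
  have h1 : Continuous fun ξ : V => ξ 0 ^ 2 + ξ 1 ^ 2 := by fun_prop
  have h2 : Continuous fun ξ : V => |ξ 2| := by fun_prop
  have ho : IsOpen {ξ : V | 1 < ξ 0 ^ 2 + ξ 1 ^ 2 ∧ ξ 0 ^ 2 + ξ 1 ^ 2 < 4 ∧ |ξ 2| < ε} :=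
    (isOpen_lt continuous_const h1).inter
      ((isOpen_lt h1 continuous_const).inter (isOpen_lt h2 continuous_const))
  refine lt_of_lt_of_le (ho.measure_pos volume ⟨!₂[3 / 2, 0, 0], ?_⟩)
    (measure_mono fun ξ h => ⟨h.1.le, h.2.1.le, h.2.2.le⟩)
  refine ⟨?_, ?_, ?_⟩
  · norm_num
  · norm_num
  · simpa using hε

theorem volume_slab_lt_top {ε : ℝ} (hε : ε ≤ 1) : volume (slab ε) < ⊤ :=
  lt_of_le_of_lt (measure_mono fun ξ h => by simpa using (norm_of_mem_slab hε h).2)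
    (measure_closedBall_lt_top (x := (0 : V)) (r := 3))

/-- The Fourier transform `i α (ξ₂, -ξ₁, 0)` on the slab of a field without vertical component. -/
def slabProfile (α ε : ℝ) : V → VC :=
  (slab ε).indicator fun ξ => (α * Complex.I) • WithLp.toLp 2 ![(ξ 1 : ℂ), -(ξ 0 : ℂ), 0]

theorem norm_sq_slabProfile {α ε : ℝ} {ξ : V} (h : ξ ∈ slab ε) :
    ‖slabProfile α ε ξ‖ ^ 2 = α ^ 2 * (ξ 0 ^ 2 + ξ 1 ^ 2) := by
  rw [slabProfile, Set.indicator_of_mem h, norm_smul, mul_pow, EuclideanSpace.norm_sq_eq,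
    Fin.sum_univ_three]
  simp [add_comm]

theorem aestronglyMeasurable_slabProfile (α ε : ℝ) :
    AEStronglyMeasurable (slabProfile α ε) volume := by
  refine AEStronglyMeasurable.indicator ?_ (measurableSet_slab ε)
  have hc : Continuous fun ξ : V => (![(ξ 1 : ℂ), -(ξ 0 : ℂ), 0] : Fin 3 → ℂ) :=
    continuous_pi fun i => ?_
  · exact (((PiLp.continuous_toLp 2 (fun _ : Fin 3 => ℂ)).comp hc).const_smul
      (α * Complex.I)).aestronglyMeasurable
  fin_cases i
  · exact (by fun_prop : Continuous fun ξ : V => (ξ 1 : ℂ))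
  · exact (by fun_prop : Continuous fun ξ : V => -(ξ 0 : ℂ))
  · exact continuous_const

theorem norm_slabProfile_le (α ε : ℝ) (ξ : V) :
    ‖slabProfile α ε ξ‖ ≤ (slab ε).indicator (fun _ => 2 * |α|) ξ := by
  by_cases h : ξ ∈ slab ε
  · rw [Set.indicator_of_mem h]
    refine le_of_sq_le_sq ?_ (by positivity)
    rw [norm_sq_slabProfile h, mul_pow, sq_abs]
    nlinarith [h.2.1, sq_nonneg α]
  · rw [slabProfile, Set.indicator_of_notMem h, Set.indicator_of_notMem h, norm_zero]

theorem memLp_slabProfile (α : ℝ) {ε : ℝ} (hε : ε ≤ 1) (p : ℝ≥0∞) :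
    MemLp (slabProfile α ε) p volume :=
  (memLp_indicator_const p (measurableSet_slab ε) (2 * |α|) (Or.inr (volume_slab_lt_top hε).ne)).of_le
    (aestronglyMeasurable_slabProfile α ε) (Filter.Eventually.of_forall fun ξ =>
      (norm_slabProfile_le α ε ξ).trans (Real.le_norm_self _))

open ComplexConjugate in
theorem slabProfile_neg (α ε : ℝ) (ξ : V) (i : Fin 3) :
    slabProfile α ε (-ξ) i = conj (slabProfile α ε ξ i) := by
  have hm : -ξ ∈ slab ε ↔ ξ ∈ slab ε := by simp [slab]
  by_cases h : ξ ∈ slab ε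
  · rw [slabProfile, Set.indicator_of_mem h, Set.indicator_of_mem (hm.2 h)]
    fin_cases i <;> simp
  · rw [slabProfile, Set.indicator_of_notMem h, Set.indicator_of_notMem (mt hm.1 h)]
    simp

/-- The slab fields: the amplitude is normalised by the volume of the slab, so that the norm of the
field stays comparable to `M` while its horizontal vorticity is of size `ε M`. -/
theorem exists_slab_field {M ε : ℝ} (hM : 0 < M) (hε : 0 < ε) (hε1 : ε ≤ 1) :
    ∃ u : Field, MemH1df u ∧ M ≤ ‖u‖ ∧ ‖u‖ ≤ 2 * M ∧
      (∀ᵐ ξ, freq u ξ ≠ 0 → 1 ≤ ‖ξ‖ ∧ ‖ξ‖ ≤ 3) ∧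
      hDotNorm (-1 / 2) (horizontal (curl (toDist u))) ≤
        ENNReal.ofReal (2 * Real.pi * ε * ‖u‖) := by
  have hpi := Real.pi_gt_three
  have hv0 := volume_slab_pos hε
  have hv1 := volume_slab_lt_top hε1
  set v := (volume (slab ε)).toReal with hv
  have hvpos : 0 < v := ENNReal.toReal_pos hv0.ne' hv1.ne
  set α := M / Real.sqrt v with hα
  have hαv : α ^ 2 * v = M ^ 2 := by
    rw [hα, div_pow, Real.sq_sqrt hvpos.le]
    field_simp
  have hmem := memLp_slabProfile α hε1 2
  obtain ⟨u, hu⟩ := exists_field_freq_eq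
    (memLp_one_iff_integrable.1 (memLp_slabProfile α hε1 1)) hmem (slabProfile_neg α ε)
  have hae : (freq u : V → VC) =ᵐ[volume] slabProfile α ε := by
    rw [hu]
    exact hmem.coeFn_toLp
  have hsupp : ∀ᵐ ξ, freq u ξ ≠ 0 → 1 ≤ ‖ξ‖ ∧ ‖ξ‖ ≤ 3 := by
    filter_upwards [hae] with ξ hξ hne
    rw [hξ] at hne
    exact norm_of_mem_slab hε1 (Set.mem_of_indicator_ne_zero hne)
  have hnorm : ENNReal.ofReal (‖u‖ ^ 2) = ∫⁻ ξ in slab ε,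
      ENNReal.ofReal (α ^ 2 * (ξ 0 ^ 2 + ξ 1 ^ 2)) := by
    rw [← lintegral_freq_sq, ← lintegral_indicator (measurableSet_slab ε)]
    refine lintegral_congr_ae ?_
    filter_upwards [hae] with ξ hξ
    rw [hξ, ← ofReal_norm, ← ENNReal.ofReal_pow (norm_nonneg _)]
    by_cases h : ξ ∈ slab ε
    · rw [Set.indicator_of_mem h, norm_sq_slabProfile h]
    · rw [Set.indicator_of_notMem h, slabProfile, Set.indicator_of_notMem h]
      simp
  have hconst : ∀ c : ℝ, 0 ≤ c → ∫⁻ _ in slab ε, ENNReal.ofReal (α ^ 2 * c) =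
      ENNReal.ofReal (c * M ^ 2) := fun c hc => by
    rw [setLIntegral_const, ← ENNReal.ofReal_toReal hv1.ne, ← ENNReal.ofReal_mul (by positivity),
      ← hαv]
    congr 1
    ring
  have hlow : M ≤ ‖u‖ := by
    have h : ENNReal.ofReal (1 * M ^ 2) ≤ ENNReal.ofReal (‖u‖ ^ 2) := by
      rw [← hconst 1 zero_le_one, hnorm]
      refine setLIntegral_mono' (measurableSet_slab ε) fun ξ hξ => ENNReal.ofReal_le_ofReal ?_
      exact mul_le_mul_of_nonneg_left hξ.1 (sq_nonneg α)
    rw [ENNReal.ofReal_le_ofReal_iff (by positivity), one_mul] at h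
    exact le_of_sq_le_sq h (norm_nonneg _)
  have hup : ‖u‖ ≤ 2 * M := by
    have h : ENNReal.ofReal (‖u‖ ^ 2) ≤ ENNReal.ofReal (4 * M ^ 2) := by
      rw [← hconst 4 (by norm_num), hnorm]
      refine setLIntegral_mono' (measurableSet_slab ε) fun ξ hξ => ENNReal.ofReal_le_ofReal ?_
      exact mul_le_mul_of_nonneg_left hξ.2.1 (sq_nonneg α)
    rw [ENNReal.ofReal_le_ofReal_iff (by positivity)] at h
    exact le_of_sq_le_sq (by linarith) (by positivity)
  refine ⟨u, ⟨(memSobolev_one_iff u).2 ?_, ?_⟩, hlow, hup, hsupp,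
    hDotNorm_le_of_ae_le (represents_curlHat u) (by positivity) ?_⟩
  · have hm : AEStronglyMeasurable
        (fun ξ => (((1 + ‖ξ‖ ^ 2) ^ (1 / 2 : ℝ) : ℝ) : ℂ) • freq u ξ) volume := by
      refine AEStronglyMeasurable.smul (Measurable.aestronglyMeasurable (f := fun ξ : V =>
          (((1 + ‖ξ‖ ^ 2) ^ (1 / 2 : ℝ) : ℝ) : ℂ)) (by fun_prop))
        (Lp.aestronglyMeasurable (freq u))
    refine (Lp.memLp (freq u)).of_le_mul (c := 4) hm ?_
    filter_upwards [hsupp] with ξ hξ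
    rw [norm_smul, Complex.norm_real, Real.norm_of_nonneg (by positivity), ← Real.sqrt_eq_rpow]
    by_cases h0 : freq u ξ = 0
    · simp [h0]
    · gcongr
      refine Real.sqrt_le_iff.2 ⟨by norm_num, ?_⟩
      nlinarith [(hξ h0).2, norm_nonneg ξ]
  · filter_upwards [hae] with ξ hξ
    change ∑ i, ((ξ i : ℝ) : ℂ) * freq u ξ i = 0
    rw [hξ, Fin.sum_univ_three]
    by_cases h : ξ ∈ slab ε
    · rw [slabProfile, Set.indicator_of_mem h]
      simp
      ring
    · rw [slabProfile, Set.indicator_of_notMem h]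
      simp
  · filter_upwards [hae] with ξ hξ
    rw [hξ]
    by_cases h : ξ ∈ slab ε
    · have h1 := (norm_of_mem_slab hε1 h).1
      have hle1 : (2 * Real.pi * ‖ξ‖) ^ (-1 / 2 : ℝ) ≤ 1 :=
        Real.rpow_le_one_of_one_le_of_nonpos (by nlinarith) (by norm_num)
      have hle2 : ‖curlHat ξ (slabProfile α ε ξ)‖ ≤ 2 * Real.pi * ε * ‖slabProfile α ε ξ‖ := by
        refine le_of_sq_le_sq ?_ (by positivity)
        have h2 : slabProfile α ε ξ 2 = 0 := by
          rw [slabProfile, Set.indicator_of_mem h]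
          simp
        have h3 : ξ 2 ^ 2 ≤ ε ^ 2 := by
          rw [← sq_abs]
          have := h.2.2
          gcongr
        rw [norm_sq_curlHat, show (2 * Real.pi * ε * ‖slabProfile α ε ξ‖) ^ 2 =
          (2 * Real.pi) ^ 2 * (ε ^ 2 * ‖slabProfile α ε ξ‖ ^ 2) by ring,
          EuclideanSpace.norm_sq_eq (slabProfile α ε ξ), Fin.sum_univ_three, h2]
        refine mul_le_mul_of_nonneg_left ?_ (by positivity)
        simp only [mul_zero, zero_sub, sub_zero, norm_neg, norm_mul, Complex.norm_real, mul_pow,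
          Real.norm_eq_abs, sq_abs, norm_zero]
        nlinarith [sq_nonneg ‖slabProfile α ε ξ 0‖, sq_nonneg ‖slabProfile α ε ξ 1‖]
      exact (mul_le_of_le_one_left (norm_nonneg _) hle1).trans hle2
    · rw [slabProfile, Set.indicator_of_notMem h]
      have h0 : ‖curlHat ξ 0‖ ^ 2 = 0 := by
        rw [norm_sq_curlHat]
        simp
      rw [sq_eq_zero_iff.1 h0]
      simp

theorem ae_norm_le_of_support {u : Field}
    (h : ∀ᵐ ξ, freq u ξ ≠ 0 → 1 ≤ ‖ξ‖ ∧ ‖ξ‖ ≤ 3) {s : ℝ} (hs0 : 0 ≤ s) (hs1 : s ≤ 1) :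
    ∀ᵐ ξ, ‖freq u ξ‖ ≤ (2 * Real.pi * ‖ξ‖) ^ s * ‖freq u ξ‖ ∧
      (2 * Real.pi * ‖ξ‖) ^ s * ‖freq u ξ‖ ≤ 6 * Real.pi * ‖freq u ξ‖ := by
  have hpi := Real.pi_gt_three
  filter_upwards [h] with ξ hξ
  by_cases h0 : freq u ξ = 0
  · simp [h0]
  · obtain ⟨h1, h2⟩ := hξ h0
    have h3 : 1 ≤ 2 * Real.pi * ‖ξ‖ := by nlinarith
    refine ⟨le_mul_of_one_le_left (norm_nonneg _) (Real.one_le_rpow h3 hs0), ?_⟩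
    gcongr
    calc (2 * Real.pi * ‖ξ‖) ^ s ≤ (2 * Real.pi * ‖ξ‖) ^ (1 : ℝ) :=
          Real.rpow_le_rpow_of_exponent_le h3 hs1
      _ ≤ 6 * Real.pi := by
          rw [Real.rpow_one]
          nlinarith

/-- `Γ_2d` contains fields of arbitrarily large `L²` norm with frequencies in a fixed annulus. -/
theorem exists_mem_Gamma2d {ν : ℝ} (hν : 0 < ν) {M : ℝ} (hM : 0 < M) :
    ∃ u ∈ Gamma2d ν, M ≤ ‖u‖ ∧ ∀ᵐ ξ, freq u ξ ≠ 0 → 1 ≤ ‖ξ‖ ∧ ‖ξ‖ ≤ 3 := by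
  have hR₁ := R₁_pos
  have hR₂ := R₂_pos
  set Q := Real.exp ((1 / 4 * (2 * M) ^ 2 * (12 * Real.pi * M) ^ 2) / (R₂ * ν ^ 3)) with hQ
  have hQ0 : 0 < Q := Real.exp_pos _
  have hpi := Real.pi_pos
  -- `ε` is chosen after `M`, small enough to absorb the exponential factor
  set ε := min 1 (R₁ * ν / (8 * Real.pi * M * Q)) with hε
  have hε0 : 0 < ε := lt_min one_pos (by positivity)
  obtain ⟨u, hmem, hlow, hup, hsupp, hvort⟩ := exists_slab_field hM hε0 (min_le_left _ _)
  refine ⟨u, ⟨hmem, ?_⟩, hlow, hsupp⟩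
  have hA : (hDotNorm (-1 / 2) (horizontal (curl (toDist u)))).toReal ≤ 4 * Real.pi * ε * M := by
    refine (ENNReal.toReal_le_of_le_ofReal (by positivity) hvort).trans ?_
    nlinarith [mul_le_mul_of_nonneg_left hup (show 0 ≤ 2 * Real.pi * ε by positivity)]
  have hH : (hDotNorm 1 (toDist u)).toReal ≤ 12 * Real.pi * M := by
    have h1 : hDotNorm 1 (toDist u) ≤ ENNReal.ofReal (6 * Real.pi * ‖u‖) :=
      hDotNorm_le_of_ae_le (represents_freq u) (by positivity)
        ((ae_norm_le_of_support hsupp zero_le_one le_rfl).mono fun ξ h => h.2)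
    refine (ENNReal.toReal_le_of_le_ofReal (by positivity) h1).trans ?_
    nlinarith [mul_le_mul_of_nonneg_left hup (show 0 ≤ 6 * Real.pi by positivity)]
  have hexp : Real.exp ((1 / 4 * ‖u‖ ^ 2 * (hDotNorm 1 (toDist u)).toReal ^ 2
      - 6912 * Real.pi ^ 4 * ν ^ 4) / (R₂ * ν ^ 3)) ≤ Q := by
    refine Real.exp_le_exp.2 ?_
    have h0 : 0 ≤ (hDotNorm 1 (toDist u)).toReal := ENNReal.toReal_nonneg
    have h1 : 0 ≤ 6912 * Real.pi ^ 4 * ν ^ 4 := by positivity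
    gcongr
    calc _ ≤ 1 / 4 * ‖u‖ ^ 2 * (hDotNorm 1 (toDist u)).toReal ^ 2 := by linarith
      _ ≤ _ := by gcongr
  calc _ ≤ 4 * Real.pi * ε * M * Q := by gcongr
    _ ≤ 4 * Real.pi * (R₁ * ν / (8 * Real.pi * M * Q)) * M * Q := by
        gcongr
        exact min_le_right _ _
    _ = R₁ * ν / 2 := by
        field_simp
        ring
    _ < R₁ * ν := half_lt_self (by positivity)

/-! ### The critical Besov norm with `p = 2` -/

theorem besovNorm_half_two_lt_top (P : DyadicPartition) {u : Field} (hu : MemH1df u) :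
    besovNorm P (1 / 2) 2 (toDist u) < ⊤ := by
  obtain ⟨a, b, ha, -, hab⟩ := P.exists_annulus
  set z := ‖u‖ * (hDotNorm 1 (toDist u)).toReal with hz
  have hz0 : 0 ≤ z := mul_nonneg (norm_nonneg _) ENNReal.toReal_nonneg
  have hN := lintegral_norm_mul_freq_le hu.1
  rw [← hz, ← Real.sq_sqrt hz0] at hN
  rw [besovNorm, if_neg (by norm_num)]
  refine lt_of_le_of_lt (iSup_le fun j => ?_)
    (ENNReal.ofReal_lt_top (r := Real.sqrt (a⁻¹ * z)))
  obtain ⟨h, hh, hlp⟩ := exists_dyadicBlock_eq P j u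
  have h1 := lintegral_block_sq_le ha hab hN j hh
  rw [hlp, enorm_fourierInv, ← ENNReal.pow_le_pow_left_iff two_ne_zero, mul_pow, eLpNorm_two_sq]
  refine (mul_le_mul_right h1 _).trans ?_
  rw [← ENNReal.ofReal_pow (by positivity), ← ENNReal.ofReal_mul (by positivity),
    ← ENNReal.ofReal_pow (by positivity)]
  refine ENNReal.ofReal_le_ofReal (le_of_eq ?_)
  have e : ((2 : ℝ) ^ ((j : ℝ) * (1 / 2))) ^ 2 = 2 ^ j := by
    rw [← Real.rpow_natCast, ← Real.rpow_mul (by norm_num), ← Real.rpow_intCast]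
    congr 1
    push_cast
    ring
  rw [e, Real.sq_sqrt hz0, Real.sq_sqrt (by positivity)]
  field_simp

/-- A field with frequencies in a fixed annulus meets only boundedly many dyadic blocks, so its `L²`
norm is controlled by the largest of them. -/
theorem exists_norm_le_besovNorm (P : DyadicPartition) :
    ∃ c : ℝ, 0 ≤ c ∧ ∀ u : Field, (∀ᵐ ξ, freq u ξ ≠ 0 → 1 ≤ ‖ξ‖ ∧ ‖ξ‖ ≤ 3) →
      ENNReal.ofReal ‖u‖ ≤ ENNReal.ofReal c * besovNorm P (1 / 2) 2 (toDist u) := by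
  obtain ⟨a, b, ha, hb, hab⟩ := P.exists_annulus
  obtain ⟨m, hm⟩ := pow_unbounded_of_one_lt b (one_lt_two (α := ℝ))
  obtain ⟨n, hn⟩ := pow_unbounded_of_one_lt (3 / a) (one_lt_two (α := ℝ))
  set J := Finset.Icc (-(m : ℤ)) n with hJ
  have hJmem : ∀ (j : ℤ) (ξ : V), 1 ≤ ‖ξ‖ → ‖ξ‖ ≤ 3 →
      P.φ ((2 : ℝ) ^ (-j) • ξ) ≠ 0 → j ∈ J := by
    intro j ξ h1 h3 h0
    obtain ⟨hl, hu⟩ := hab j ξ h0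
    have hj : (0 : ℝ) < 2 ^ j := by positivity
    rw [hJ, Finset.mem_Icc]
    constructor
    · have h4 : (2 : ℝ) ^ (0 : ℤ) < 2 ^ ((m : ℤ) + j) := by
        rw [zpow_zero, zpow_add₀ two_ne_zero, zpow_natCast]
        nlinarith
      have := (zpow_lt_zpow_iff_right₀ one_lt_two).1 h4
      omega
    · have h4 : (2 : ℝ) ^ j < 2 ^ (n : ℤ) := by
        rw [zpow_natCast]
        refine lt_of_le_of_lt ?_ hn
        rw [le_div_iff₀ ha]
        linarith
      exact ((zpow_lt_zpow_iff_right₀ one_lt_two).1 h4).le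
  refine ⟨∑ j ∈ J, (2 : ℝ) ^ (-((j : ℝ) * (1 / 2))), by positivity, fun u hu => ?_⟩
  choose h hh hlp using fun j : ℤ => exists_dyadicBlock_eq P j u
  have hsum : (freq u : V → VC) =ᵐ[volume] ∑ j ∈ J, (h j : V → VC) := by
    have hall : ∀ᵐ ξ, ∀ j, h j ξ = ((P.φ ((2 : ℝ) ^ (-j) • ξ) : ℝ) : ℂ) • freq u ξ :=
      ae_all_iff.2 hh
    filter_upwards [hall, hu] with ξ h1 h2
    rw [Finset.sum_apply]
    simp only [h1]
    rw [← Finset.sum_smul, ← Complex.ofReal_sum]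
    by_cases h0 : freq u ξ = 0
    · simp [h0]
    · obtain ⟨h3, h4⟩ := h2 h0
      have hne : ξ ≠ 0 := by
        rintro rfl
        norm_num at h3
      have h5 := (hasSum_sum_of_ne_finset_zero (L := .unconditional ℤ)
        (f := fun j : ℤ => P.φ ((2 : ℝ) ^ (-j) • ξ)) (s := J)
        fun j hj => by_contra fun h6 => hj (hJmem j ξ h3 h4 h6)).unique (P.hasSum ξ hne)
      rw [h5]
      simp
  have hblock : ∀ j, eLpNorm (h j : V → VC) 2 volume ≤
      ENNReal.ofReal ((2 : ℝ) ^ (-((j : ℝ) * (1 / 2)))) * besovNorm P (1 / 2) 2 (toDist u) := by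
    intro j
    have h1 : ENNReal.ofReal ((2 : ℝ) ^ ((j : ℝ) * (1 / 2))) * eLpNorm (h j : V → VC) 2 volume ≤
        besovNorm P (1 / 2) 2 (toDist u) := by
      rw [besovNorm, if_neg (by norm_num), ← enorm_fourierInv, ← hlp]
      exact le_iSup (fun j : ℤ => ENNReal.ofReal ((2 : ℝ) ^ ((j : ℝ) * (1 / 2))) *
        lpNorm 2 (dyadicBlock P j (toDist u))) j
    refine le_trans (le_of_eq ?_) (mul_le_mul_right h1 _)
    rw [← mul_assoc, ← ENNReal.ofReal_mul (by positivity), ← Real.rpow_add two_pos,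
      neg_add_cancel, Real.rpow_zero, ENNReal.ofReal_one, one_mul]
  calc ENNReal.ofReal ‖u‖ = eLpNorm (freq u : V → VC) 2 volume := by
        rw [← Lp.enorm_def, ← ofReal_norm, freq, Lp.norm_fourier_eq, norm_toComplex]
    _ ≤ ∑ j ∈ J, eLpNorm (h j : V → VC) 2 volume := by
        rw [eLpNorm_congr_ae hsum]
        exact eLpNorm_sum_le (fun j _ => Lp.aestronglyMeasurable _) (by norm_num)
    _ ≤ _ := by
        rw [ENNReal.ofReal_sum_of_nonneg fun j _ => by positivity, Finset.sum_mul]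
        exact Finset.sum_le_sum fun j _ => hblock j

end AlmostTwoDim

end

theorem mainTheorem2 (ν : ℝ) (hν : 0 < ν) (P : DyadicPartition) :
    (∀ M : ℝ≥0, ∃ u ∈ Gamma2d ν,
      (M : ℝ≥0∞) < hDotNorm (1 / 2) (toDist u) ∧ hDotNorm (1 / 2) (toDist u) < ⊤) ∧
    (∀ M : ℝ≥0, ∃ u ∈ Gamma2d ν,
      (M : ℝ≥0∞) < besovNorm P (1 / 2) 2 (toDist u) ∧ besovNorm P (1 / 2) 2 (toDist u) < ⊤) ∧
    (∀ p : ℝ≥0∞, 2 < p → ∃ C : ℝ≥0, ∀ u ∈ Gamma2d ν,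
      besovNorm P (-1 + (3 / p).toReal) p (toDist u) ≤ C) := by
  refine ⟨fun M => ?_, fun M => ?_, fun p hp => exists_besovNorm_Gamma2d_le hν P hp⟩
  · obtain ⟨u, hu, hMu, hsupp⟩ := exists_mem_Gamma2d hν (M := M + 1) (by positivity)
    have hae := ae_norm_le_of_support hsupp (s := 1 / 2) (by norm_num) (by norm_num)
    refine ⟨u, hu, ?_, ?_⟩
    · refine lt_of_lt_of_le ?_ (le_hDotNorm_of_ae_le (represents_freq u) (hae.mono fun ξ h => h.1))
      rw [← ENNReal.ofReal_coe_nnreal]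
      exact (ENNReal.ofReal_lt_ofReal_iff_of_nonneg M.coe_nonneg).2 ((lt_add_one _).trans_le hMu)
    · exact lt_of_le_of_lt (hDotNorm_le_of_ae_le (represents_freq u) (by positivity)
        (hae.mono fun ξ h => h.2)) ENNReal.ofReal_lt_top
  · obtain ⟨c, hc, hbd⟩ := exists_norm_le_besovNorm P
    obtain ⟨u, hu, hMu, hsupp⟩ := exists_mem_Gamma2d hν (M := c * M + 1) (by positivity)
    refine ⟨u, hu, ?_, besovNorm_half_two_lt_top P hu.1⟩
    by_contra! hle
    have h1 := (hbd u hsupp).trans (mul_le_mul_right hle _)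
    rw [← ENNReal.ofReal_coe_nnreal, ← ENNReal.ofReal_mul hc,
      ENNReal.ofReal_le_ofReal_iff (by positivity)] at h1
    linarith
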